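/- **Setting.** Let $n$ workers and a server minimize $f=\frac1n\sum_{i=1}^n f_i$ over $\mathbb R^d$ from $x^0=0$. For $0\le\mu\le L$, $\Delta\ge 0$, $\mathcal F^{\Delta}_{L,\mu}$ is the class of $(f_i)_{i=1}^n$ with $\frac\mu2\|y-x\|^2\le f_i(y)-f_i(x)-\langle\nabla f_i(x),y-x\rangle\le\frac L2\|y-x\|^2$ for all $x,y,i$, and $\|x^0-x^\star\|^2\le\Delta$ for some minimizer $x^\star$ of $f$; put $\kappa=L/\mu$. $\mathcal U_\omega$ is the set of families of random maps $(C_i)_{i=1}^n$ on $\mathbb R^d$ with $\mathbb E[C_i(x)]=x$ and $\mathbb E\|C_i(x)-x\|^2\le\omega\|x\|^2$ for all $x,i$; within a round the $C_i$ may depend on each other arbitrarily, and different rounds use fresh randomness. In a linear-spanning algorithm, in round $t=1,2,\dots$ the server broadcasts $u^t$, worker $i$ queries $\nabla f_i$ on a set $\mathcal Y_i^t$ and sends $\hat v_i^t=C_i(v_i^t)$, and the server outputs $\hat x^t$, where $u^t\in\mathrm{span}\{u^r,\hat v_j^r: r<t,\ j\le n\}$; $\mathcal Y_i^t\subseteq\mathrm{span}(\{u^r\}_{r\le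 t}\cup\{\nabla f_i(y):y\in\mathcal Y_i^r,r<t\}\cup\{\hat v_i^r\}_{r<t})$; $v_i^t\in\mathrm{span}(\{u^r\}_{r\le t}\cup\{\nabla f_i(y):y\in\mathcal Y_i^r,r\le t\}\cup\{\hat v_i^r\}_{r<t})$; $\hat x^t\in\mathrm{span}\{u^r,\hat v_j^r:r\le t,\ j\le n\}$; also $\hat x^0=0$. The algorithm may be randomized; the server's decisions use only what it has received, and those of worker $i$ only $f_i$, the broadcasts and its own compressed messages. Let $T_\epsilon=\min\{t\in\mathbb N:\mathbb E[f(\hat x^t)]-\min f\le\epsilon\}$ ($\infty$ if there is none). The per-round cost of $C_i$ at precision $r\ge1$ is the least $b$ such that one fixed decoder recovers, for every $x\in[-1,1]^d$, almost surely $C_i(x)$ from some $b$-bit word up to an error of at most $2^{-r}$ in each entry ($\infty$ if there is none). For a family of compressors it is the common value (in general the maximum) of the costs of its members, and $\mathrm{TCC}_\epsilon$ is the per-round cost of the family times $T_\epsilon$. **Theorem.** Unbiased compression alone does not reduce the order of the total communication cost ($r$ being regarded as a constant): 1. There is an absolute constant $c>0$ such that every member of every family in $\mathcal U_\omega$ has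 per-round cost at least $c\,d/(1+\omega)$, for all $n$, $d$, $\omega\ge0$ and $r\ge1$. 2. (Strongly convex.) For every $\kappa_0>1$ there are $c,c_0,K>0$ depending only on $\kappa_0$ such that for all $\mu,\Delta>0$, $L\ge\kappa_0\mu$, $\omega\ge0$, $0<\epsilon\le c_0\mu\Delta$, all sufficiently large $d$ (depending on $L,\mu,\Delta,\omega,\epsilon$), and all $n\ge2$, there are $(f_i)\in\mathcal F^\Delta_{L,\mu}$ and $(C_i)\in\mathcal U_\omega$ such that, at every precision $r\ge1$, all $C_i$ have the same per-round cost, which is at most $K\frac{d}{1+\omega}(r+\log_2(1+\omega))$, and every linear-spanning algorithm on $\{(f_i,C_i)\}$ satisfies $$T_\epsilon\ge c(1+\omega)\sqrt{\kappa}\,\ln\frac{\mu\Delta}{\epsilon},\qquad \mathrm{TCC}_\epsilon\ge c\,d\,\sqrt{\kappa}\,\ln\frac{\mu\Delta}{\epsilon}\quad\text{for all } r\ge1.$$ 3. (Generally convex.) There are absolute constants $c,c_0,K>0$ such that for all $L,\Delta>0$, $\omega\ge0$, $0<\epsilon\le c_0L\Delta$, all sufficiently large $d$ (depending on $L,\Delta,\omega,\epsilon$),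 and all $n\ge2$, there are $(f_i)\in\mathcal F^\Delta_{L,0}$ and $(C_i)\in\mathcal U_\omega$, with equal per-round costs bounded as in 2, such that every linear-spanning algorithm on $\{(f_i,C_i)\}$ satisfies $$T_\epsilon\ge c(1+\omega)\sqrt{\frac{L\Delta}{\epsilon}},\qquad \mathrm{TCC}_\epsilon\ge c\,d\,\sqrt{\frac{L\Delta}{\epsilon}}\quad\text{for all } r\ge1.$$ 4. These orders, which do not depend on $\omega$, are those of uncompressed methods. The family $C_i=\mathrm{id}$ belongs to $\mathcal U_\omega$ for all $\omega\ge0$, and there are absolute constants $c_0,K>0$ such that for all $n\ge1$, $d$ and $L\ge\mu>0$ there is one algorithm that, with $C_i=\mathrm{id}$, is linear-spanning on every $(f_i)\in\mathcal F^\Delta_{L,\mu}$, for every $\Delta$, and satisfies $\mathrm{TCC}_\epsilon\le K\,r\,d\,\sqrt\kappa\,\ln\frac{\mu\Delta}{\epsilon}$ for all $0<\epsilon\le c_0\mu\Delta$ and $r\ge1$; likewise for all $n\ge1$, $d$ and $L>0$ there is one that is linear-spanning on every $(f_i)\in\mathcal F^\Delta_{L,0}$ and satisfies $\mathrm{TCC}_\epsilon\le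 K\,r\,d\,\sqrt{L\Delta/\epsilon}$ for all $0<\epsilon\le c_0L\Delta$ and $r\ge1$. -/

import Mathlib

open MeasureTheory
open scoped ENNReal

universe u v

noncomputable section

namespace DistOpt

/-- The space `ℝ^d` with its Euclidean norm. -/
abbrev E (d : ℕ) : Type := EuclideanSpace ℝ (Fin d)

/-! ### The optimization problem -/

/-- The global objective `f = (1/n) ∑ f_i`. -/
def avg {n d : ℕ} (f : Fin n → E d → ℝ) (x : E d) : ℝ :=
  (1 / (n : ℝ)) * ∑ i, f i x

/-- The function class `F_{L,μ}^Δ` for the starting point `x⁰ = 0`: every local function is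
differentiable, `L`-smooth and `μ`-strongly convex, and some global minimizer `x⋆` of the average
satisfies `‖x⁰ - x⋆‖² ≤ Δ`. -/
structure InClass {n d : ℕ} (L μ Δ : ℝ) (f : Fin n → E d → ℝ) : Prop where
  differentiable : ∀ i, Differentiable ℝ (f i)
  strong_convex : ∀ i (x y : E d),
    μ / 2 * ‖y - x‖ ^ 2 ≤ f i y - f i x - inner ℝ (gradient (f i) x) (y - x)
  smooth : ∀ i (x y : E d),
    f i y - f i x - inner ℝ (gradient (f i) x) (y - x) ≤ L / 2 * ‖y - x‖ ^ 2
  minimizer : ∃ xs : E d, (∀ y, avg f xs ≤ avg f y) ∧ ‖(0 : E d) - xs‖ ^ 2 ≤ Δ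

/-! ### Compressors -/

/-- A family of `n` random compressors `C_i : ℝ^d → ℝ^d`. In each communication round one seed is
drawn from `law` and used by all the workers, so that the joint law of the compressors of the
different workers within a round is arbitrary (identical, independent, or anything else). -/
structure CompressorFamily (n d : ℕ) where
  Seed : Type u
  [measurableSpace : MeasurableSpace Seed]
  law : Measure Seed
  [isProbabilityMeasure : IsProbabilityMeasure law]
  compress : Fin n → Seed → E d → E d
  measurable_compress : ∀ i, Measurable fun p : Seed × E d => compress i p.1 p.2

attribute [instance] CompressorFamily.measurableSpace CompressorFamily.isProbabilityMeasure

namespace CompressorFamily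

variable {n d : ℕ}

/-- All the compressors of the family are `ω`-unbiased: `𝔼[C_i(x)] = x` and
`𝔼[‖C_i(x) - x‖²] ≤ ω ‖x‖²` for all `x`. No independence is required. -/
def IsUnbiased (ω : ℝ) (C : CompressorFamily.{u} n d) : Prop :=
  ∀ (i : Fin n) (x : E d),
    Integrable (fun s => C.compress i s x) C.law ∧
    ∫ s, C.compress i s x ∂C.law = x ∧
    Integrable (fun s => ‖C.compress i s x - x‖ ^ 2) C.law ∧
    ∫ s, ‖C.compress i s x - x‖ ^ 2 ∂C.law ≤ ω * ‖x‖ ^ 2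

/-- At a precision of `r` bits per entry (for numbers in `[-1, 1]`: errors of at most `2^{-r}` in
an entry are ignored), the messages `C_i(x)` can be encoded by words of `b` bits: a
fixed decoder recovers from some `b`-bit word, up to an error of `2^{-r}` in each entry, whatever
`C_i` outputs on any input with entries in `[-1, 1]`. -/
def EncodableIn (C : CompressorFamily.{u} n d) (r : ℕ) (i : Fin n) (b : ℕ) : Prop :=
  ∃ decode : (Fin b → Bool) → E d, ∀ x : E d, (∀ k, |x k| ≤ 1) →
    ∀ᵐ s ∂C.law, ∃ w, ∀ k, |decode w k - C.compress i s x k| ≤ (2 : ℝ)⁻¹ ^ r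

/-- The number of bits that worker `i` sends per round, at a precision of `r` bits per entry
(`⊤` if no finite number suffices). -/
def bitCost (C : CompressorFamily.{u} n d) (r : ℕ) (i : Fin n) : ℕ∞ :=
  ⨅ (b : ℕ) (_ : C.EncodableIn r i b), (b : ℕ∞)

/-- The per-round communication cost of the family, per worker. (It is meant for families whose
members all have the same cost; in general, it is the largest of the costs.) -/
def perRoundCost (C : CompressorFamily.{u} n d) (r : ℕ) : ℕ∞ :=
  ⨆ i, C.bitCost r i

end CompressorFamily

/-- No compression: every `C_i` is the identity. -/
def noCompression (n d : ℕ) : CompressorFamily.{0} n d where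
  Seed := Unit
  law := Measure.dirac ()
  compress := fun _ _ x => x
  measurable_compress := fun _ => measurable_snd

/-! ### Algorithms -/

/-- A centralized, synchronous, possibly randomized algorithm for `n` workers and one server, with
compression of the messages from the workers to the server. Rounds are numbered `0, 1, 2, …`.
`Coin` holds the internal randomness of the algorithm.
* `broadcast t` is the vector that the server sends at the start of round `t`; it depends on the
  messages received in the rounds `< t`.
* `query i t` is the set of vectors at which worker `i`, which has the local function `f_i`,
  evaluates its gradient in round `t`, and `message i t` is the vector that it then wants to send
  (before compression); they depend on the vectors broadcast in the rounds `≤ t` and on its own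
  compressed messages of the rounds `< t`.
* `output t` is the model that the server outputs after `t` rounds. -/
structure Algorithm (n d : ℕ) where
  Coin : Type v
  [measurableSpace : MeasurableSpace Coin]
  coinLaw : Measure Coin
  [isProbabilityMeasure : IsProbabilityMeasure coinLaw]
  broadcast : (t : ℕ) → Coin → (Fin t → Fin n → E d) → E d
  query : (i : Fin n) → (t : ℕ) → Coin → (E d → ℝ) → (Fin (t + 1) → E d) → (Fin t → E d) →
    Set (E d)
  message : (i : Fin n) → (t : ℕ) → Coin → (E d → ℝ) → (Fin (t + 1) → E d) → (Fin t → E d) → E d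
  output : (t : ℕ) → Coin → (Fin t → Fin n → E d) → E d
  measurable_broadcast : ∀ t,
    Measurable fun p : Coin × (Fin t → Fin n → E d) => broadcast t p.1 p.2
  measurable_message : ∀ i t (φ : E d → ℝ),
    Measurable fun p : Coin × (Fin (t + 1) → E d) × (Fin t → E d) =>
      message i t p.1 φ p.2.1 p.2.2
  measurable_output : ∀ t,
    Measurable fun p : Coin × (Fin t → Fin n → E d) => output t p.1 p.2

attribute [instance] Algorithm.measurableSpace Algorithm.isProbabilityMeasure

namespace Algorithm

variable {n d : ℕ}

/-- The compressed message `C_i(v_i^t)` that the server receives from worker `i` in round `t`, when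
the algorithm runs on `(f, C)` with coin `c` and with the compressor seed `ξ t` in round `t`. -/
def recv (A : Algorithm.{v} n d) (f : Fin n → E d → ℝ) (C : CompressorFamily.{u} n d)
    (c : A.Coin) (ξ : ℕ → C.Seed) (t : ℕ) (i : Fin n) : E d :=
  C.compress i (ξ t)
    (A.message i t c (f i)
      (fun s : Fin (t + 1) =>
        A.broadcast s c (fun (r : Fin s) (j : Fin n) => recv A f C c ξ r j))
      (fun s : Fin t => recv A f C c ξ s i))
termination_by t
decreasing_by
  · have _h1 := r.isLt
    have _h2 := s.isLt
    omega
  · exact s.isLt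

section Run

variable (A : Algorithm.{v} n d) (f : Fin n → E d → ℝ) (C : CompressorFamily.{u} n d)
  (c : A.Coin) (ξ : ℕ → C.Seed)

/-- The vector `u^t` broadcast by the server in round `t`. -/
def sent (t : ℕ) : E d :=
  A.broadcast t c (fun (r : Fin t) (j : Fin n) => A.recv f C c ξ r j)

/-- The set `Y_i^t` of gradient queries of worker `i` in round `t`. -/
def queries (t : ℕ) (i : Fin n) : Set (E d) :=
  A.query i t c (f i) (fun s : Fin (t + 1) => A.sent f C c ξ s)
    (fun s : Fin t => A.recv f C c ξ s i)

/-- The vector `v_i^t` that worker `i` sends in round `t`, before compression. -/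
def msg (t : ℕ) (i : Fin n) : E d :=
  A.message i t c (f i) (fun s : Fin (t + 1) => A.sent f C c ξ s)
    (fun s : Fin t => A.recv f C c ξ s i)

/-- The output of the server after `t` communication rounds. -/
def out (t : ℕ) : E d :=
  A.output t c (fun (r : Fin t) (j : Fin n) => A.recv f C c ξ r j)

end Run

/-- The algorithm is linear-spanning on the instance `(f, C)`. -/
structure LinearSpanning (A : Algorithm.{v} n d) (f : Fin n → E d → ℝ)
    (C : CompressorFamily.{u} n d) : Prop where
  sent_mem : ∀ c ξ t, A.sent f C c ξ t ∈ Submodule.span ℝ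
    ({x | ∃ r < t, x = A.sent f C c ξ r} ∪ {x | ∃ r < t, ∃ i, x = A.recv f C c ξ r i})
  queries_subset : ∀ c ξ t i, A.queries f C c ξ t i ⊆ Submodule.span ℝ
    ({x | ∃ r ≤ t, x = A.sent f C c ξ r} ∪
      {x | ∃ r < t, ∃ y ∈ A.queries f C c ξ r i, x = gradient (f i) y} ∪
      {x | ∃ r < t, x = A.recv f C c ξ r i})
  msg_mem : ∀ c ξ t i, A.msg f C c ξ t i ∈ Submodule.span ℝ
    ({x | ∃ r ≤ t, x = A.sent f C c ξ r} ∪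
      {x | ∃ r ≤ t, ∃ y ∈ A.queries f C c ξ r i, x = gradient (f i) y} ∪
      {x | ∃ r < t, x = A.recv f C c ξ r i})
  out_mem : ∀ c ξ t, A.out f C c ξ t ∈ Submodule.span ℝ
    ({x | ∃ r < t, x = A.sent f C c ξ r} ∪ {x | ∃ r < t, ∃ i, x = A.recv f C c ξ r i})

/-- The expected suboptimality `𝔼[f(x̂^t)] - min f` after `t` rounds. The seeds of the different
rounds are independent with law `C.law`, and independent of the coin of the algorithm. -/
def expectedGap (A : Algorithm.{v} n d) (f : Fin n → E d → ℝ) (C : CompressorFamily.{u} n d)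
    (t : ℕ) : ℝ≥0∞ :=
  ∫⁻ p, ENNReal.ofReal (avg f (A.out f C p.1 p.2 t) - ⨅ x, avg f x)
    ∂(A.coinLaw.prod (Measure.infinitePi fun _ : ℕ => C.law))

/-- The convergence complexity `T_ε`: the least number of rounds after which the expected
suboptimality is at most `ε` (`⊤` if there is none). -/
def rounds (A : Algorithm.{v} n d) (f : Fin n → E d → ℝ) (C : CompressorFamily.{u} n d)
    (ε : ℝ) : ℕ∞ :=
  ⨅ (t : ℕ) (_ : A.expectedGap f C t ≤ ENNReal.ofReal ε), (t : ℕ∞)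

/-- The total communication cost `TCC_ε` (in bits, per worker), at a precision of `r` bits per
entry: the per-round cost times the number of rounds. -/
def tcc (A : Algorithm.{v} n d) (f : Fin n → E d → ℝ) (C : CompressorFamily.{u} n d)
    (r : ℕ) (ε : ℝ) : ℝ≥0∞ :=
  (C.perRoundCost r : ℝ≥0∞) * (A.rounds f C ε : ℝ≥0∞)

end Algorithm

end DistOpt

end

noncomputable section

namespace DistOpt

/-! Cost of a round. Feed an `ω`-unbiased compressor a sign vector `σ`. Unbiasedness gives
correlation `d` with `σ` on average, and the variance bound keeps the mean squared norm at most `(1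
+ ω) d`, so some decoder output `D` has `⟨D, σ⟩ - λ‖D‖² ≥ 3d/16` with `λ = 1/(8(1 + ω))`
(`exists_correlated_codeword`). One `D` can serve few of the `2^d` sign vectors, because random sign
sums are subgaussian (`sum_exp_signVec_le`). Counting forces `2^b ≥ exp(3d/(64(1 + ω)))`.

Number of rounds. The hard objective is Nesterov's chain quadratic, whose links are split between
the workers by parity. A worker that knows vectors supported on the first `k` coordinates can reach
at most one more coordinate, however many local gradients it takes (`chainGrad_mem`, `reach_reach`).
All the workers keep the same random residue class of coordinates modulo `m = ⌊1 + ω⌋`, so the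
server obtains the next coordinate with probability only `1/m` per round, whatever `n` is
(`progress_invariant`). Hence the count of reached coordinates satisfies `𝔼 φ^progress = (1 - (1 -
φ)/m)^t` (`integral_pow_progress`). The minimizer is geometric with ratio `q`, so with `φ = q²` the
gap after `k` coordinates is at least `μΔ/2 (φ^k - φ^d)` (`hardFun_gap`). As `-log φ` is of order at
most `1/√κ`, about `m √κ log(μΔ/ε)` rounds are needed. The convex case is the strongly convex one
with `μ = 16ε/Δ`.

Total cost. The factor `1 + ω` lost in rounds cancels the factor saved per round. Without
compression, an accelerated gradient method with a decreasing potential (`accelerated_step`,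
`InClass.acc_potential`) attains the same orders at `r d` bits per round. -/

/-! ### Lower bound on the per-round cost -/

/-- The vector with entries `±1` given by a boolean word. -/
def signVec {d : ℕ} (σ : Fin d → Bool) : E d :=
  WithLp.toLp 2 fun k => if σ k then 1 else -1

/-- The sum factorizes over the coordinates, and each factor is `2 cosh(θ D_k) exp(-(θ D_k)²/2) ≤
2`: this is the subgaussian bound for signs. -/
theorem sum_exp_signVec_le {d : ℕ} (θ : ℝ) (D : E d) :
    ∑ σ : Fin d → Bool, Real.exp (∑ k, θ * D k * signVec σ k - θ ^ 2 / 2 * ∑ k, D k ^ 2) ≤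
      2 ^ d := by
  have h1 : ∀ σ : Fin d → Bool,
      Real.exp (∑ k, θ * D k * signVec σ k - θ ^ 2 / 2 * ∑ k, D k ^ 2) =
        ∏ k, Real.exp ((θ * D k) * (if σ k then 1 else -1) - θ ^ 2 / 2 * D k ^ 2) := by
    intro σ
    rw [← Real.exp_sum, Finset.sum_sub_distrib, Finset.mul_sum]
    rfl
  have h2 : ∀ k, ∑ b : Bool, Real.exp ((θ * D k) * (if b then 1 else -1) - θ ^ 2 / 2 * D k ^ 2) ≤
      2 := by
    intro k
    have h := Real.cosh_le_exp_half_sq (θ * D k)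
    rw [Real.cosh_eq] at h
    have h3 : (Real.exp (θ * D k) + Real.exp (-(θ * D k))) *
        Real.exp (-(θ ^ 2 / 2 * D k ^ 2)) ≤ 2 := by
      rw [Real.exp_neg (θ ^ 2 / 2 * D k ^ 2), ← div_eq_mul_inv, div_le_iff₀ (Real.exp_pos _)]
      have : (θ * D k) ^ 2 / 2 = θ ^ 2 / 2 * D k ^ 2 := by ring
      rw [this] at h
      linarith
    simp only [Fintype.sum_bool, if_true, Bool.false_eq_true, if_false, mul_one, mul_neg,
      sub_eq_add_neg, Real.exp_add]
    linarith
  simp_rw [h1]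
  have h3 := Finset.prod_univ_sum (fun _ : Fin d => (Finset.univ : Finset Bool))
    (fun k b => Real.exp ((θ * D k) * (if b then 1 else -1) - θ ^ 2 / 2 * D k ^ 2))
  rw [Fintype.piFinset_univ] at h3
  rw [← h3]
  calc _ ≤ ∏ _k : Fin d, (2 : ℝ) :=
        Finset.prod_le_prod (fun k _ => Finset.sum_nonneg fun b _ => (Real.exp_pos _).le)
          fun k _ => h2 k
    _ = 2 ^ d := by simp

theorem sum_signVec_sq {d : ℕ} (σ : Fin d → Bool) : ∑ k, signVec σ k ^ 2 = (d : ℝ) := by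
  have : ∀ k, signVec σ k ^ 2 = 1 := by
    intro k
    simp only [signVec]
    split <;> norm_num
  simp [this]

theorem norm_signVec_sq {d : ℕ} (σ : Fin d → Bool) : ‖signVec σ‖ ^ 2 = (d : ℝ) := by
  rw [EuclideanSpace.real_norm_sq_eq, sum_signVec_sq]

/-- Some codeword is well correlated with a given sign vector. -/
theorem exists_correlated_codeword {n d r b : ℕ} {ω : ℝ} (hr : 1 ≤ r) (hω : 0 ≤ ω)
    {C : CompressorFamily.{u} n d} (hC : C.IsUnbiased ω) (i : Fin n)
    {decode : (Fin b → Bool) → E d}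
    (hdec : ∀ x : E d, (∀ k, |x k| ≤ 1) →
      ∀ᵐ s ∂C.law, ∃ w, ∀ k, |decode w k - C.compress i s x k| ≤ (2 : ℝ)⁻¹ ^ r)
    (σ : Fin d → Bool) :
    ∃ w, 3 / 16 * (d : ℝ) ≤
      ∑ k, decode w k * signVec σ k - (1 / (8 * (1 + ω))) * ∑ k, decode w k ^ 2 := by
  obtain ⟨h1, h2, h3, h4⟩ := hC i (signVec σ)
  set x := signVec σ with hx
  have hlam0 : 0 < 1 / (8 * (1 + ω)) := by positivity
  set lam := 1 / (8 * (1 + ω)) with hlam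
  have hlam1 : lam * (1 + ω) = 1 / 8 := by rw [hlam]; field_simp
  have hlamle : lam ≤ 1 / 8 := by nlinarith
  have hxabs : ∀ k, |x k| = 1 := by
    intro k
    simp only [hx, signVec]
    split <;> norm_num
  have hnx : ‖x‖ ^ 2 = d := norm_signVec_sq σ
  have hinner : Integrable (fun s => inner ℝ x (C.compress i s x)) C.law := h1.const_inner x
  have hinner2 : ∫ s, inner ℝ x (C.compress i s x) ∂C.law = d := by
    rw [integral_inner h1, h2, real_inner_self_eq_norm_sq, hnx]
  -- `‖C‖² = ‖C - x‖² + 2⟨x, C⟩ - ‖x‖²`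
  let g : C.Seed → ℝ := fun s => (1 - 4 * lam) * inner ℝ x (C.compress i s x)
    - 2 * lam * ‖C.compress i s x - x‖ ^ 2 + (2 * lam * d - d / 2 - lam * (d / 2))
  have hgi : Integrable g C.law :=
    ((hinner.const_mul _).sub (h3.const_mul _)).add (integrable_const _)
  -- The mean is at least `d (1/2 - 2 lam (1 + ω) - lam/2)`; here `2 lam (1 + ω) = 1/4` and `lam ≤
  -- 1/8`, which leaves `1/4 - 1/16 = 3/16`.
  have hg : 3 / 16 * (d : ℝ) ≤ ∫ s, g s ∂C.law := by
    have : ∫ s, g s ∂C.law = (1 - 4 * lam) * d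
        - 2 * lam * (∫ s, ‖C.compress i s x - x‖ ^ 2 ∂C.law)
        + (2 * lam * d - d / 2 - lam * (d / 2)) := by
      have hsub : Integrable (fun s => (1 - 4 * lam) * inner ℝ x (C.compress i s x)
          - 2 * lam * ‖C.compress i s x - x‖ ^ 2) C.law :=
        (hinner.const_mul _).sub (h3.const_mul _)
      simp only [g]
      rw [integral_add hsub (integrable_const _), integral_sub (hinner.const_mul _) (h3.const_mul _), integral_const_mul,
        integral_const_mul, hinner2]
      simp
    rw [this]
    have h5 : lam * (∫ s, ‖C.compress i s x - x‖ ^ 2 ∂C.law) ≤ lam * (ω * d) := by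
      rw [← hnx]; gcongr
    have hd : (0 : ℝ) ≤ d := by positivity
    nlinarith
  -- `g` reaches its mean with positive probability, so this can be combined with the almost sure
  -- decoding.
  obtain ⟨s, hs, w, hw⟩ : ∃ s, (3 / 16 * (d : ℝ) ≤ g s) ∧
      ∃ w, ∀ k, |decode w k - C.compress i s x k| ≤ (2 : ℝ)⁻¹ ^ r := by
    have hae := hdec x (fun k => (hxabs k).le)
    have hpos := measure_integral_le_pos hgi
    obtain ⟨s, hs1, hs2⟩ :=
      (frequently_ae_iff.mpr hpos.ne').and_eventually hae |>.exists
    exact ⟨s, hg.trans hs1, hs2⟩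
  refine ⟨w, hs.trans ?_⟩
  have hhalf : (2 : ℝ)⁻¹ ^ r ≤ 1 / 2 := by
    calc (2 : ℝ)⁻¹ ^ r ≤ (2 : ℝ)⁻¹ ^ 1 :=
          pow_le_pow_of_le_one (by norm_num) (by norm_num) hr
      _ = 1 / 2 := by norm_num
  set y := C.compress i s x with hy
  have e1 : inner ℝ x y = ∑ k, y k * x k := by
    simp [PiLp.inner_apply]
  have e2 : ‖y - x‖ ^ 2 = ∑ k, (y k - x k) ^ 2 := by
    simp [EuclideanSpace.real_norm_sq_eq]
  have e3 : (d : ℝ) = ∑ k, x k ^ 2 := (sum_signVec_sq σ).symm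
  -- Passing from `y` to the decoded vector costs at most `1/2` in the product and uses `decode² ≤
  -- 2y² + 1/2`; expanding `y² = (y - x)² + 2xy - x²` yields the coordinatewise form of `g`.
  have key : ∀ k, (1 - 4 * lam) * (y k * x k) - 2 * lam * (y k - x k) ^ 2 +
      (2 * lam * x k ^ 2 - 1 / 2 - lam * (1 / 2)) ≤
      decode w k * x k - lam * decode w k ^ 2 := by
    intro k
    have h6 := (hw k).trans hhalf
    have h7 : |(decode w k - y k) * x k| ≤ 1 / 2 := by rw [abs_mul, hxabs, mul_one]; exact h6
    have h8 := (abs_le.mp h7).1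
    have h9 : (decode w k - y k) ^ 2 ≤ 1 / 4 := by
      have := sq_le_sq' (abs_le.mp h6).1 (abs_le.mp h6).2
      linarith
    have h10 : decode w k ^ 2 ≤ 2 * y k ^ 2 + 1 / 2 := by
      nlinarith [sq_nonneg (decode w k - 2 * y k)]
    nlinarith
  have hsum := Finset.sum_le_sum fun k (_ : k ∈ Finset.univ) => key k
  have hconst : ∑ _k : Fin d, ((1 : ℝ) / 2 + lam * (1 / 2)) = d / 2 + lam * (d / 2) := by
    simp; ring
  calc g s = ∑ k, ((1 - 4 * lam) * (y k * x k) - 2 * lam * (y k - x k) ^ 2 +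
      (2 * lam * x k ^ 2 - 1 / 2 - lam * (1 / 2))) := by
        simp only [g]
        simp only [Finset.sum_add_distrib, Finset.sum_sub_distrib, ← Finset.mul_sum]
        rw [← e1, ← e2, ← e3]
        simp only [Finset.sum_const, Finset.card_univ, Fintype.card_fin, nsmul_eq_mul]
        ring
    _ ≤ _ := hsum
    _ = _ := by rw [Finset.sum_sub_distrib, Finset.mul_sum]

/-- An `ω`-unbiased compressor needs at least `3 d / (64 (1 + ω))` bits per round. -/
theorem encodable_bits_lower_bound {n d r b : ℕ} {ω : ℝ} (hr : 1 ≤ r) (hω : 0 ≤ ω)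
    {C : CompressorFamily.{u} n d} (hC : C.IsUnbiased ω) (i : Fin n)
    (henc : C.EncodableIn r i b) : 3 / 64 * ((d : ℝ) / (1 + ω)) ≤ b := by
  obtain ⟨decode, hdec⟩ := henc
  have hpos : 0 < 1 + ω := by positivity
  -- With `θ = 2λ` the penalty `θ²/2` of the exponential bound equals `θ λ`, so the exponent is `θ`
  -- times the score of the codeword.
  set θ := 2 * (1 / (8 * (1 + ω))) with hθ
  have hθ0 : 0 < θ := by positivity
  have h1 : ∀ σ : Fin d → Bool, Real.exp (θ * (3 / 16 * d)) ≤
      ∑ w, Real.exp (∑ k, θ * decode w k * signVec σ k - θ ^ 2 / 2 * ∑ k, decode w k ^ 2) := by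
    intro σ
    obtain ⟨w, hw⟩ := exists_correlated_codeword hr hω hC i hdec σ
    refine le_trans ?_ (Finset.single_le_sum (f := fun w => Real.exp
      (∑ k, θ * decode w k * signVec σ k - θ ^ 2 / 2 * ∑ k, decode w k ^ 2))
      (fun w _ => (Real.exp_pos _).le) (Finset.mem_univ w))
    refine Real.exp_le_exp.mpr ((mul_le_mul_of_nonneg_left hw hθ0.le).trans (le_of_eq ?_))
    simp only [mul_assoc]
    rw [← Finset.mul_sum, mul_sub]
    congr 1
    rw [hθ]; ring
  -- Double counting of pairs (sign vector, codeword), weighted exponentially.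
  have h2 : (2 : ℝ) ^ d * Real.exp (θ * (3 / 16 * d)) ≤ 2 ^ b * 2 ^ d := by
    calc (2 : ℝ) ^ d * Real.exp (θ * (3 / 16 * d))
        = ∑ _σ : Fin d → Bool, Real.exp (θ * (3 / 16 * d)) := by simp
      _ ≤ ∑ σ : Fin d → Bool, ∑ w, Real.exp
          (∑ k, θ * decode w k * signVec σ k - θ ^ 2 / 2 * ∑ k, decode w k ^ 2) :=
          Finset.sum_le_sum fun σ _ => h1 σ
      _ = ∑ w, ∑ σ : Fin d → Bool, Real.exp
          (∑ k, θ * decode w k * signVec σ k - θ ^ 2 / 2 * ∑ k, decode w k ^ 2) :=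
          Finset.sum_comm
      _ ≤ ∑ _w : Fin b → Bool, (2 : ℝ) ^ d :=
          Finset.sum_le_sum fun w _ => sum_exp_signVec_le θ (decode w)
      _ = 2 ^ b * 2 ^ d := by simp
  have h3 : Real.exp (θ * (3 / 16 * d)) ≤ 2 ^ b := by
    have : (0 : ℝ) < 2 ^ d := by positivity
    nlinarith
  have h4 : θ * (3 / 16 * d) ≤ b * Real.log 2 := by
    have := Real.log_le_log (Real.exp_pos _) h3
    rwa [Real.log_exp, Real.log_pow] at this
  have h5 : (b : ℝ) * Real.log 2 ≤ b := by
    have := Real.log_two_lt_d9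
    have hb : (0 : ℝ) ≤ b := by positivity
    nlinarith
  have h6 : 3 / 64 * ((d : ℝ) / (1 + ω)) = θ * (3 / 16 * d) := by
    rw [hθ]; field_simp; ring
  linarith

/-- Bit costs and round counts are both infima of this shape. Rounding `B` up to a natural number
makes it a bound in `ℕ∞`; an empty `p` gives `⊤`. -/
theorem ofReal_le_toENNReal_of_forall {p : ℕ → Prop} {B : ℝ}
    (h : ∀ t, p t → B ≤ t) :
    ENNReal.ofReal B ≤ ((⨅ (t : ℕ) (_ : p t), (t : ℕ∞) : ℕ∞) : ℝ≥0∞) := by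
  have h1 : ((⌈B⌉₊ : ℕ) : ℕ∞) ≤ ⨅ (t : ℕ) (_ : p t), (t : ℕ∞) :=
    le_iInf₂ fun t ht => by exact_mod_cast Nat.ceil_le.mpr (h t ht)
  calc ENNReal.ofReal B ≤ ENNReal.ofReal (⌈B⌉₊ : ℕ) :=
        ENNReal.ofReal_le_ofReal (Nat.le_ceil B)
    _ = (((⌈B⌉₊ : ℕ) : ℕ∞) : ℝ≥0∞) := by simp
    _ ≤ _ := by exact_mod_cast h1

theorem bitCost_lower_bound {n d r : ℕ} {ω : ℝ} (hr : 1 ≤ r) (hω : 0 ≤ ω)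
    {C : CompressorFamily.{u} n d} (hC : C.IsUnbiased ω) (i : Fin n) :
    ENNReal.ofReal (3 / 64 * (d / (1 + ω))) ≤ (C.bitCost r i : ℝ≥0∞) :=
  ofReal_le_toENNReal_of_forall fun _ => encodable_bits_lower_bound hr hω hC i

/-! ### Upper bounds on bit costs -/

/-- The midpoint of the `q`-th of the intervals of length `2 · 2^{-r}` that partition `[-M, M]`. -/
def dequantize (M r q : ℕ) : ℝ := (2 * q + 1) * (2 : ℝ)⁻¹ ^ r - M

theorem exists_dequantize {M r Q : ℕ} (hM : 1 ≤ M) (hQ : M * 2 ^ r ≤ Q) {y : ℝ}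
    (hy : |y| ≤ M) : ∃ q : Fin Q, |dequantize M r q - y| ≤ (2 : ℝ)⁻¹ ^ r := by
  have hp : (0 : ℝ) < 2 ^ r := by positivity
  have hpos : 0 < M * 2 ^ r := by positivity
  obtain ⟨hy1, hy2⟩ := abs_le.mp hy
  set z : ℝ := (y + M) * 2 ^ r / 2 with hz
  have hz0 : 0 ≤ z := by
    have : 0 ≤ y + M := by linarith
    positivity
  have hzM : z ≤ M * 2 ^ r := by rw [hz]; nlinarith
  have hyz : y = 2 * z * (2 : ℝ)⁻¹ ^ r - M := by
    rw [hz, inv_pow]; field_simp; ring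
  have hinv : (0 : ℝ) < (2 : ℝ)⁻¹ ^ r := by positivity
  suffices h : ∃ q : ℕ, q < M * 2 ^ r ∧ (q : ℝ) ≤ z ∧ z ≤ q + 1 by
    obtain ⟨q, hq, h1, h2⟩ := h
    refine ⟨⟨q, hq.trans_le hQ⟩, ?_⟩
    have e : dequantize M r q - y = (2 * (q - z) + 1) * (2 : ℝ)⁻¹ ^ r := by
      rw [dequantize]; linear_combination (-1 : ℝ) * hyz
    rw [e, abs_mul, abs_of_pos hinv]
    refine mul_le_of_le_one_left hinv.le (abs_le.mpr ⟨by linarith, by linarith⟩)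
  -- `z` is the position of `y` measured in cells. Only the right endpoint `y = M` falls outside the
  -- half-open cells; it goes to the last one.
  by_cases h : ⌊z⌋₊ < M * 2 ^ r
  · exact ⟨⌊z⌋₊, h, Nat.floor_le hz0, (Nat.lt_floor_add_one z).le⟩
  · push Not at h
    have h1 : ((M * 2 ^ r : ℕ) : ℝ) ≤ z := (Nat.cast_le.mpr h).trans (Nat.floor_le hz0)
    push_cast at h1
    refine ⟨M * 2 ^ r - 1, by omega, ?_, ?_⟩ <;>
    · rw [Nat.cast_sub hpos]; push_cast; linarith

namespace CompressorFamily

variable {n d : ℕ}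

/-- Words of `b` bits may be replaced by the elements of any type with at most `2^b` elements. -/
theorem encodableIn_of_card_le {C : CompressorFamily.{u} n d} {r b : ℕ} {i : Fin n}
    {W : Type*} [Fintype W] (hW : Fintype.card W ≤ 2 ^ b) (decode : W → E d)
    (h : ∀ x : E d, (∀ k, |x k| ≤ 1) →
      ∀ᵐ s ∂C.law, ∃ w, ∀ k, |decode w k - C.compress i s x k| ≤ (2 : ℝ)⁻¹ ^ r) :
    C.EncodableIn r i b := by
  classical
  have hcard : Fintype.card W ≤ Fintype.card (Fin b → Bool) := by simpa using hW
  obtain ⟨e⟩ := Function.Embedding.nonempty_of_card_le hcard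
  refine ⟨fun v => if hv : ∃ w, e w = v then decode hv.choose else 0, fun x hx => ?_⟩
  filter_upwards [h x hx] with s ⟨w, hw⟩
  refine ⟨e w, fun k => ?_⟩
  have hv : ∃ w', e w' = e w := ⟨w, rfl⟩
  rw [dif_pos hv, e.injective hv.choose_spec]
  exact hw k

theorem bitCost_le {C : CompressorFamily.{u} n d} {r b : ℕ} {i : Fin n}
    (h : C.EncodableIn r i b) : C.bitCost r i ≤ b :=
  iInf₂_le b h

theorem perRoundCost_le {C : CompressorFamily.{u} n d} {r b : ℕ}
    (h : ∀ i, C.EncodableIn r i b) : C.perRoundCost r ≤ b :=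
  iSup_le fun i => bitCost_le (h i)

end CompressorFamily

theorem perRoundCost_noCompression_le (n d r : ℕ) :
    (noCompression n d).perRoundCost r ≤ (r * d : ℕ) := by
  refine CompressorFamily.perRoundCost_le fun i =>
    CompressorFamily.encodableIn_of_card_le (W := Fin d → Fin (2 ^ r)) (by simp [pow_mul])
      (fun w => WithLp.toLp 2 fun k => dequantize 1 r (w k)) fun x hx =>
        Filter.Eventually.of_forall fun s => ?_
  have := fun k => exists_dequantize (M := 1) (r := r) (Q := 2 ^ r) le_rfl (by simp)
    (y := x k) (by simpa using hx k)
  choose w hw using this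
  exact ⟨w, hw⟩

theorem noCompression_isUnbiased (n d : ℕ) {ω : ℝ} (hω : 0 ≤ ω) :
    (noCompression n d).IsUnbiased ω := by
  intro i x
  refine ⟨integrable_const _, ?_, ?_, ?_⟩
  · exact integral_dirac (fun _ : Unit => x) ()
  · exact integrable_const (‖x - x‖ ^ 2)
  · have : ∫ _s : Unit, ‖x - x‖ ^ 2 ∂Measure.dirac () = ‖x - x‖ ^ 2 :=
      integral_dirac (fun _ : Unit => ‖x - x‖ ^ 2) ()
    refine this.le.trans ?_
    rw [sub_self, norm_zero, zero_pow two_ne_zero]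
    positivity

/-! ### Random sparsification with a shared seed -/

/-- Keep the coordinates in the residue class `s` modulo `m`, scaled by `m`. -/
def keepClass {d m : ℕ} (s : Fin m) (x : E d) : E d :=
  WithLp.toLp 2 fun k => if (k : ℕ) % m = s then m * x k else 0

/-- All the workers keep the coordinates in one residue class modulo `m`, which is drawn uniformly
at random, and scale them by `m`. -/
def classSparsifier (n d m : ℕ) [NeZero m] : CompressorFamily.{0} n d where
  Seed := Fin m
  law := (PMF.uniformOfFintype (Fin m)).toMeasure
  compress := fun _ s x => keepClass s x
  measurable_compress := fun _ => by
    refine measurable_from_prod_countable_right fun s => ?_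
    refine (WithLp.measurable_toLp 2 _).comp (measurable_pi_lambda _ fun k => ?_)
    dsimp only
    split_ifs <;> fun_prop

variable {n d m : ℕ} [NeZero m]

theorem integral_uniform {F : Type*} [NormedAddCommGroup F] [NormedSpace ℝ F] [CompleteSpace F]
    (g : Fin m → F) :
    ∫ s, g s ∂(PMF.uniformOfFintype (Fin m)).toMeasure = (m : ℝ)⁻¹ • ∑ s, g s := by
  rw [PMF.integral_eq_sum, Finset.smul_sum]
  simp

/-- Exactly one of the `m` classes contains `k`. The mean, the variance and the progress of the
chain are all computed from this. -/
theorem sum_ite_residue {F : Type*} [AddCommGroup F] (k : ℕ) (a b : F) :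
    ∑ s : Fin m, (if k % m = s then a else b) = a + (m - 1) • b := by
  have hm : 0 < m := Nat.pos_of_neZero m
  have h : ∀ s : Fin m, (if k % m = (s : ℕ) then a else b) =
      b + if (⟨k % m, Nat.mod_lt k hm⟩ : Fin m) = s then a - b else 0 := by
    intro s
    by_cases hs : k % m = (s : ℕ)
    · rw [if_pos hs, if_pos (Fin.ext hs)]; abel
    · rw [if_neg hs, if_neg fun h => hs (congrArg Fin.val h), add_zero]
  simp_rw [h]
  rw [Finset.sum_add_distrib, Finset.sum_ite_eq, if_pos (Finset.mem_univ _), Finset.sum_const,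
    Finset.card_univ, Fintype.card_fin]
  obtain ⟨m', rfl⟩ : ∃ m', m = m' + 1 := ⟨m - 1, by omega⟩
  rw [Nat.add_sub_cancel, succ_nsmul]
  abel

theorem integral_keepClass (x : E d) :
    ∫ s : Fin m, keepClass s x ∂(PMF.uniformOfFintype (Fin m)).toMeasure = x := by
  have hm0 : (m : ℝ) ≠ 0 := by exact_mod_cast NeZero.ne m
  rw [integral_uniform]
  ext k
  rw [PiLp.smul_apply, WithLp.ofLp_sum, Finset.sum_apply]
  simp only [keepClass]
  rw [sum_ite_residue]
  simp [hm0]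

/-- In each entry the error is `(m - 1) x_k` with probability `1/m` and `-x_k` otherwise, and `((m -
1)² + (m - 1))/m = m - 1`. -/
theorem integral_keepClass_sub_sq (x : E d) :
    ∫ s : Fin m, ‖keepClass s x - x‖ ^ 2 ∂(PMF.uniformOfFintype (Fin m)).toMeasure =
      (m - 1) * ‖x‖ ^ 2 := by
  have hm0 : (m : ℝ) ≠ 0 := by exact_mod_cast NeZero.ne m
  have h1 : ∀ s : Fin m, ‖keepClass s x - x‖ ^ 2 =
      ∑ k : Fin d, (if (k : ℕ) % m = s then (m - 1) ^ 2 * x k ^ 2 else x k ^ 2) := by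
    intro s
    rw [EuclideanSpace.real_norm_sq_eq]
    refine Finset.sum_congr rfl fun k _ => ?_
    simp only [PiLp.sub_apply, keepClass]
    split_ifs <;> ring
  rw [integral_uniform]
  simp_rw [h1]
  rw [Finset.sum_comm, EuclideanSpace.real_norm_sq_eq, smul_eq_mul, Finset.mul_sum,
    Finset.mul_sum]
  refine Finset.sum_congr rfl fun k _ => ?_
  rw [sum_ite_residue, nsmul_eq_mul, Nat.cast_sub (Nat.pos_of_neZero m)]
  push_cast
  field_simp
  ring

theorem classSparsifier_isUnbiased {ω : ℝ} (hm : (m : ℝ) ≤ 1 + ω) :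
    (classSparsifier n d m).IsUnbiased ω := by
  refine fun i x => ⟨Integrable.of_finite (μ := (PMF.uniformOfFintype (Fin m)).toMeasure), integral_keepClass x,
    Integrable.of_finite (μ := (PMF.uniformOfFintype (Fin m)).toMeasure), (integral_keepClass_sub_sq x).le.trans ?_⟩
  gcongr
  linarith

/-- A word names the class and then lists its at most `d / m + 1` entries, which lie in `[-m, m]`
and so need `clog 2 m` bits beyond `r`. Using classes instead of arbitrary random subsets keeps the
cost of the index logarithmic in `m`. -/
theorem classSparsifier_encodableIn (n d m r : ℕ) [NeZero m] (i : Fin n) :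
    (classSparsifier n d m).EncodableIn r i
      (Nat.clog 2 m + (r + Nat.clog 2 m) * (d / m + 1)) := by
  have hm : 0 < m := Nat.pos_of_neZero m
  have hclog : m ≤ 2 ^ Nat.clog 2 m := Nat.le_pow_clog one_lt_two m
  have hQ : m * 2 ^ r ≤ 2 ^ (r + Nat.clog 2 m) := by
    rw [pow_add, mul_comm]; exact Nat.mul_le_mul_left _ hclog
  refine CompressorFamily.encodableIn_of_card_le
    (W := Fin m × (Fin (d / m + 1) → Fin (2 ^ (r + Nat.clog 2 m)))) ?_
    (fun w => WithLp.toLp 2 fun k => if (k : ℕ) % m = w.1 then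
      dequantize m r (w.2 ⟨k / m, Nat.lt_succ_of_le (Nat.div_le_div_right k.isLt.le)⟩) else 0)
    fun x hx => Filter.Eventually.of_forall fun s => ?_
  · simp only [Fintype.card_prod, Fintype.card_fin, Fintype.card_fun]
    rw [pow_add 2 (Nat.clog 2 m), pow_mul 2 (r + Nat.clog 2 m)]
    exact Nat.mul_le_mul_right _ hclog
  · have : ∀ q : Fin (d / m + 1), ∃ v : Fin (2 ^ (r + Nat.clog 2 m)),
        ∀ hq : q.val * m + s.val < d, |dequantize m r v - m * x ⟨_, hq⟩| ≤ (2 : ℝ)⁻¹ ^ r := by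
      intro q
      by_cases hq : q.val * m + s.val < d
      · obtain ⟨v, hv⟩ := exists_dequantize hm hQ (y := m * x ⟨_, hq⟩) (by
          rw [abs_mul, Nat.abs_cast]
          exact mul_le_of_le_one_right (Nat.cast_nonneg _) (hx _))
        exact ⟨v, fun _ => hv⟩
      · exact ⟨⟨0, by positivity⟩, fun h => absurd h hq⟩
    choose v hv using this
    refine ⟨(s, v), fun k => ?_⟩
    simp only [classSparsifier, keepClass]
    split_ifs with hk
    · have hkeq : (k : ℕ) / m * m + s.val = k := by rw [← hk]; exact Nat.div_add_mod' k m
      have := hv ⟨k / m, Nat.lt_succ_of_le (Nat.div_le_div_right k.isLt.le)⟩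
        (by simp only [hkeq]; exact k.isLt)
      simpa only [hkeq] using this
    · simp

theorem bitCost_classSparsifier_eq (r : ℕ) (i j : Fin n) :
    (classSparsifier n d m).bitCost r i = (classSparsifier n d m).bitCost r j := rfl

theorem perRoundCost_classSparsifier_le {ω : ℝ} {r : ℕ} (hr : 1 ≤ r) (hm : (m : ℝ) ≤ 1 + ω)
    (hm2 : 1 + ω ≤ 2 * m) (hd : m ≤ d) :
    ((classSparsifier n d m).perRoundCost r : ℝ≥0∞) ≤
      ENNReal.ofReal (16 * (d / (1 + ω)) * (r + Real.logb 2 (1 + ω))) := by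
  have hm1 : (1 : ℝ) ≤ m := by exact_mod_cast Nat.pos_of_neZero m
  set ℓ := Nat.clog 2 m with hℓ
  have h1 : ((classSparsifier n d m).perRoundCost r : ℝ≥0∞) ≤
      ((ℓ + (r + ℓ) * (d / m + 1) : ℕ) : ℝ≥0∞) := by
    have := CompressorFamily.perRoundCost_le (classSparsifier_encodableIn n d m r)
    exact_mod_cast ENat.toENNReal_le.mpr this
  refine h1.trans ?_
  rw [← ENNReal.ofReal_natCast]
  refine ENNReal.ofReal_le_ofReal ?_
  have hlog : (ℓ : ℝ) ≤ Real.logb 2 (1 + ω) + 1 := by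
    -- By minimality of `ℓ`, `2^(ℓ - 1) < m`; the case `ℓ = 0` has to be separated because of the
    -- truncated subtraction.
    have h2 : (2 : ℝ) ^ ℓ ≤ 2 * m := by
      rcases Nat.eq_zero_or_pos ℓ with h0 | h0
      · rw [h0]; norm_num; linarith
      · have h3 : 2 ^ (ℓ - 1) < m := by
          by_contra hcon
          push Not at hcon
          have := Nat.clog_le_of_le_pow hcon
          omega
        have h4 : 2 ^ ℓ ≤ 2 * m := by
          obtain ⟨l, hl⟩ : ∃ l, ℓ = l + 1 := ⟨ℓ - 1, by omega⟩
          rw [hl] at h3 ⊢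
          rw [Nat.add_sub_cancel] at h3
          rw [pow_succ]; omega
        exact_mod_cast h4
    have h5 : (ℓ : ℝ) ≤ Real.logb 2 (2 * (1 + ω)) := by
      rw [Real.le_logb_iff_rpow_le one_lt_two (by linarith), Real.rpow_natCast]
      linarith
    rw [Real.logb_mul two_ne_zero (by linarith), Real.logb_self_eq_one one_lt_two] at h5
    linarith
  have hlog0 : 0 ≤ Real.logb 2 (1 + ω) := Real.logb_nonneg one_lt_two (by linarith)
  set lg := Real.logb 2 (1 + ω)
  have hr' : (1 : ℝ) ≤ r := by exact_mod_cast hr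
  have hrl : (r : ℝ) + ℓ ≤ 2 * (r + lg) := by linarith
  have hdm : ((d / m : ℕ) : ℝ) ≤ d / m := Nat.cast_div_le
  -- This is where `m ≤ d` is needed: the summand `1` in `d / m + 1` and the index bits are absorbed
  -- into `d / m`.
  have hdm1 : (1 : ℝ) ≤ d / m := by
    rw [le_div_iff₀ (by linarith), one_mul]; exact_mod_cast hd
  have hdω : (d : ℝ) / m ≤ 2 * (d / (1 + ω)) := by
    rw [← mul_div_assoc, div_le_div_iff₀ (by linarith) (by linarith)]
    have : (0 : ℝ) ≤ d := Nat.cast_nonneg d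
    nlinarith
  push_cast
  calc (ℓ : ℝ) + (r + ℓ) * ((d / m : ℕ) + 1) ≤ (r + ℓ) * (d / m) + (r + ℓ) * (d / m + d / m) := by
        have hp : (0 : ℝ) ≤ r + ℓ := by positivity
        have h6 : (ℓ : ℝ) ≤ (r + ℓ) * (d / m) := by nlinarith
        have h7 : ((r : ℝ) + ℓ) * ((d / m : ℕ) + 1) ≤ (r + ℓ) * (d / m + d / m) := by gcongr
        linarith
    _ = 3 * ((r + ℓ) * (d / m)) := by ring
    _ ≤ 3 * ((2 * (r + lg)) * (2 * (d / (1 + ω)))) := by gcongr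
    _ ≤ _ := by
        have : 0 ≤ (r + lg) * (d / (1 + ω)) := by
          have : 0 < 1 + ω := by linarith
          positivity
        nlinarith

/-! ### The averaged objective -/

/-- The average of the local gradients. -/
def avgGrad {n d : ℕ} (f : Fin n → E d → ℝ) (x : E d) : E d :=
  (n : ℝ)⁻¹ • ∑ i, gradient (f i) x

theorem avg_sub_eq {n d : ℕ} (f : Fin n → E d → ℝ) (x y : E d) :
    avg f y - avg f x - inner ℝ (avgGrad f x) (y - x) =
      (n : ℝ)⁻¹ * ∑ i, (f i y - f i x - inner ℝ (gradient (f i) x) (y - x)) := by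
  simp only [avg, avgGrad, real_inner_smul_left, sum_inner, Finset.sum_sub_distrib]
  ring

theorem inv_mul_sum_const {n : ℕ} (hn : 1 ≤ n) (a : ℝ) : (n : ℝ)⁻¹ * ∑ _i : Fin n, a = a := by
  have : (n : ℝ) ≠ 0 := by positivity
  simp [this]

theorem InClass.avg_lower {n d : ℕ} {L μ Δ : ℝ} {f : Fin n → E d → ℝ} (h : InClass L μ Δ f)
    (hn : 1 ≤ n) (x y : E d) :
    μ / 2 * ‖y - x‖ ^ 2 ≤ avg f y - avg f x - inner ℝ (avgGrad f x) (y - x) := by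
  rw [avg_sub_eq, ← inv_mul_sum_const hn (μ / 2 * ‖y - x‖ ^ 2)]
  gcongr with i
  exact h.strong_convex i x y

theorem InClass.avg_upper {n d : ℕ} {L μ Δ : ℝ} {f : Fin n → E d → ℝ} (h : InClass L μ Δ f)
    (hn : 1 ≤ n) (x y : E d) :
    avg f y - avg f x - inner ℝ (avgGrad f x) (y - x) ≤ L / 2 * ‖y - x‖ ^ 2 := by
  rw [avg_sub_eq, ← inv_mul_sum_const hn (L / 2 * ‖y - x‖ ^ 2)]
  gcongr with i
  exact h.smooth i x y

theorem iInf_avg_eq {n d : ℕ} {f : Fin n → E d → ℝ} {xs : E d}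
    (hxs : ∀ y, avg f xs ≤ avg f y) : ⨅ x, avg f x = avg f xs :=
  le_antisymm (ciInf_le ⟨avg f xs, by rintro _ ⟨y, rfl⟩; exact hxs y⟩ xs) (le_ciInf hxs)

/-! ### The accelerated gradient method -/

/-- One step of the accelerated gradient method does not increase the potential. -/
theorem accelerated_step {F : Type*} [NormedAddCommGroup F] [InnerProductSpace ℝ F]
    {x y z z' xs g : F} {L μ A B a fx fy fy' fs : ℝ} (hL : 0 < L) (hμ : 0 ≤ μ) (hA : 0 ≤ A)
    (ha : 0 ≤ a) (hB : 0 < B)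
    (hy' : fy' ≤ fx - ‖g‖ ^ 2 / (2 * L)) (hy : fx + inner ℝ g (y - x) ≤ fy)
    (hs : fx + inner ℝ g (xs - x) + μ / 2 * ‖xs - x‖ ^ 2 ≤ fs)
    (hx : (A + a) • x = A • y + a • z)
    (hz : (B + μ * a) • z' = B • z + (μ * a) • x - a • g)
    (hLa : L * a ^ 2 ≤ (A + a) * B) :
    (A + a) * (fy' - fs) + (B + μ * a) / 2 * ‖z' - xs‖ ^ 2 ≤
      A * (fy - fs) + B / 2 * ‖z - xs‖ ^ 2 := by
  have hx' := congrArg (fun v => inner ℝ g v) hx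
  -- Testing the update of `z` against `xs - z'` produces the change of the distance terms of the
  -- potential.
  have hz' := congrArg (fun v => inner ℝ v (xs - z')) hz
  simp only [inner_add_right, inner_smul_right] at hx'
  simp only [inner_add_left, inner_sub_left, inner_sub_right, real_inner_smul_left] at hz'
  -- Completing the square in `B (z' - z) + a g`; the resulting `‖g‖²` term is paid by the descent
  -- of `fy'`, through `hLa`.
  have hquad : 0 ≤ B / 2 * ‖z' - z‖ ^ 2 + a * inner ℝ g (z' - z) + a ^ 2 * ‖g‖ ^ 2 / (2 * B) := by
    have h0 : 0 ≤ ‖B • (z' - z) + a • g‖ ^ 2 / (2 * B) := by positivity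
    rw [norm_add_sq_real, norm_smul, norm_smul, real_inner_smul_left, inner_smul_right,
      real_inner_comm, mul_pow, mul_pow, Real.norm_eq_abs, Real.norm_eq_abs, sq_abs, sq_abs] at h0
    refine h0.trans (le_of_eq ?_)
    field_simp
  have hstep : a ^ 2 * ‖g‖ ^ 2 / (2 * B) ≤ (A + a) * (‖g‖ ^ 2 / (2 * L)) := by
    rw [← mul_div_assoc, div_le_div_iff₀ (by positivity) (by positivity)]
    nlinarith [mul_le_mul_of_nonneg_right hLa (sq_nonneg ‖g‖)]
  have hdist : 0 ≤ μ * a * ‖z' - x‖ ^ 2 := by positivity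
  have h1 := mul_le_mul_of_nonneg_left hy' (add_nonneg hA ha)
  have h2 := mul_le_mul_of_nonneg_left hy hA
  have h3 := mul_le_mul_of_nonneg_left hs ha
  simp only [norm_sub_sq_real, inner_sub_right] at *
  rw [real_inner_self_eq_norm_sq] at hz'
  rw [real_inner_comm z' z, real_inner_comm z' x, real_inner_comm xs x,
    real_inner_comm xs z] at hz'
  rw [real_inner_comm xs z]
  nlinarith

/-- The square roots of the weights of the accelerated gradient method. -/
def accWeight (L μ : ℝ) : ℕ → ℝ
  | 0 => 0
  | k + 1 => accWeight L μ k + √((1 + μ * accWeight L μ k ^ 2) / L) / 2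

section Weights

variable {L μ : ℝ}

theorem accWeight_nonneg (k : ℕ) : 0 ≤ accWeight L μ k := by
  induction k with
  | zero => exact le_rfl
  | succ k ih => rw [accWeight]; positivity

theorem accWeight_le_succ (k : ℕ) : accWeight L μ k ≤ accWeight L μ (k + 1) := by
  rw [accWeight]
  linarith [Real.sqrt_nonneg ((1 + μ * accWeight L μ k ^ 2) / L)]

theorem accWeight_succ_pos (hL : 0 < L) (hμ : 0 ≤ μ) (k : ℕ) : 0 < accWeight L μ (k + 1) := by
  rw [accWeight]
  have := accWeight_nonneg (L := L) (μ := μ) k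
  positivity

/-- This is the condition `L a² ≤ (A + a) B` of `accelerated_step` for `A = S²`. An increment `ρ/2`
of `S` with `L ρ² = B` turns the left side into `B (S + ρ/4)²`, so no quadratic equation has to be
solved. -/
theorem accWeight_step (hL : 0 < L) (hμ : 0 ≤ μ) (k : ℕ) :
    L * (accWeight L μ (k + 1) ^ 2 - accWeight L μ k ^ 2) ^ 2 ≤
      accWeight L μ (k + 1) ^ 2 * (1 + μ * accWeight L μ k ^ 2) := by
  have hS := accWeight_nonneg (L := L) (μ := μ) k
  rw [accWeight]
  set S := accWeight L μ k
  set B := 1 + μ * S ^ 2 with hB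
  have hB0 : 0 < B := by positivity
  have hr := Real.sq_sqrt (show 0 ≤ B / L by positivity)
  have hr0 := Real.sqrt_nonneg (B / L)
  set ρ := √(B / L)
  have hLρ : L * ρ ^ 2 = B := by rw [hr]; field_simp
  have e : L * ((S + ρ / 2) ^ 2 - S ^ 2) ^ 2 = B * (S + ρ / 4) ^ 2 := by
    rw [← hLρ]; ring
  rw [e, mul_comm B]
  gcongr
  norm_num

theorem accWeight_linear (hL : 0 < L) (hμ : 0 ≤ μ) (k : ℕ) :
    k / (2 * √L) ≤ accWeight L μ k := by
  induction k with
  | zero => simp [accWeight]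
  | succ k ih =>
    rw [accWeight]
    have h1 : 1 / √L ≤ √((1 + μ * accWeight L μ k ^ 2) / L) := by
      rw [Real.sqrt_div' _ hL.le]
      gcongr
      rw [Real.one_le_sqrt]
      have : 0 ≤ μ * accWeight L μ k ^ 2 := by positivity
      linarith
    have h2 : ((k + 1 : ℕ) : ℝ) / (2 * √L) = k / (2 * √L) + 1 / √L / 2 := by
      push_cast; field_simp
    linarith

/-- The increment is at least `√(μ/L)/2` times the current weight. As the weight starts at `0`, this
is useful only after a first phase of linear growth, hence the offset `j`. -/
theorem accWeight_geometric (hL : 0 < L) (hμ : 0 ≤ μ) (j k : ℕ) :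
    accWeight L μ j * (1 + √(μ / L) / 2) ^ k ≤ accWeight L μ (j + k) := by
  induction k with
  | zero => simp
  | succ k ih =>
    rw [← Nat.add_assoc, accWeight, pow_succ, ← mul_assoc]
    have hS := accWeight_nonneg (L := L) (μ := μ) (j + k)
    have h1 : √(μ / L) * accWeight L μ (j + k) ≤
        √((1 + μ * accWeight L μ (j + k) ^ 2) / L) := by
      refine Real.le_sqrt_of_sq_le ?_
      rw [mul_pow, Real.sq_sqrt (by positivity), div_mul_eq_mul_div]
      gcongr
      linarith
    have h2 := mul_le_mul_of_nonneg_right ih (show 0 ≤ 1 + √(μ / L) / 2 by positivity)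
    linarith

end Weights

/-- The point at which the accelerated gradient method evaluates the gradient in round `k`. -/
def accQuery {d : ℕ} (L μ : ℝ) (k : ℕ) (p : E d × E d) : E d :=
  (accWeight L μ (k + 1) ^ 2)⁻¹ • (accWeight L μ k ^ 2 • p.1 +
    (accWeight L μ (k + 1) ^ 2 - accWeight L μ k ^ 2) • p.2)

/-- The two sequences of the accelerated gradient method, fed with the gradients `G k`. -/
def accState {d : ℕ} (L μ : ℝ) (G : ℕ → E d) : ℕ → E d × E d
  | 0 => 0
  | k + 1 =>
    (accQuery L μ k (accState L μ G k) - L⁻¹ • G k,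
      (1 + μ * accWeight L μ (k + 1) ^ 2)⁻¹ •
        ((1 + μ * accWeight L μ k ^ 2) • (accState L μ G k).2 +
          (μ * (accWeight L μ (k + 1) ^ 2 - accWeight L μ k ^ 2)) •
            accQuery L μ k (accState L μ G k) -
          (accWeight L μ (k + 1) ^ 2 - accWeight L μ k ^ 2) • G k))

/-- Lets the finite history of the server, padded by zeros, be replaced by the infinite sequence of
averaged gradients. -/
theorem accState_congr {d : ℕ} (L μ : ℝ) {G G' : ℕ → E d} (t : ℕ) (h : ∀ k < t, G k = G' k) :
    accState L μ G t = accState L μ G' t := by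
  induction t with
  | zero => rfl
  | succ t ih => simp only [accState, ih fun k hk => h k (by omega), h t (by omega)]

theorem measurable_accState {α : Type*} [MeasurableSpace α] {d : ℕ} (L μ : ℝ)
    {G : α → ℕ → E d} (hG : ∀ k, Measurable fun a => G a k) (t : ℕ) :
    Measurable fun a => accState L μ (G a) t := by
  induction t with
  | zero => exact measurable_const
  | succ t ih =>
    have hGt := hG t
    simp only [accState, accQuery]
    fun_prop

/-- The averages of the messages of the past rounds. -/
def avgHistory {n d t : ℕ} (h : Fin t → Fin n → E d) (k : ℕ) : E d :=
  if hk : k < t then (n : ℝ)⁻¹ • ∑ i, h ⟨k, hk⟩ i else 0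

theorem measurable_accState_avgHistory (n d : ℕ) (L μ : ℝ) (t : ℕ) :
    Measurable fun p : Unit × (Fin t → Fin n → E d) => accState L μ (avgHistory p.2) t := by
  refine measurable_accState L μ (fun k => ?_) t
  unfold avgHistory
  split_ifs <;> fun_prop

theorem measurable_gradient {d : ℕ} (φ : E d → ℝ) : Measurable (gradient φ) :=
  (InnerProductSpace.toDual ℝ (E d)).symm.continuous.measurable.comp (measurable_fderiv ℝ φ)

/-- The distributed accelerated gradient method. -/
def acceleratedGradient (n d : ℕ) (L μ : ℝ) : Algorithm.{0} n d where
  Coin := Unit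
  coinLaw := Measure.dirac ()
  broadcast := fun t _ h => accQuery L μ t (accState L μ (avgHistory h) t)
  query := fun _ t _ _ u _ => {u (Fin.last t)}
  message := fun _ t _ φ u _ => gradient φ (u (Fin.last t))
  output := fun t _ h => (accState L μ (avgHistory h) t).1
  measurable_broadcast := fun t => by
    have := measurable_accState_avgHistory n d L μ t
    simp only [accQuery]
    fun_prop
  measurable_message := fun _ t φ => (measurable_gradient φ).comp (by fun_prop)
  measurable_output := fun t => (measurable_accState_avgHistory n d L μ t).fst

section Run

variable {n d : ℕ} {L μ : ℝ} (f : Fin n → E d → ℝ)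
  (c : (acceleratedGradient n d L μ).Coin) (ξ : ℕ → (noCompression n d).Seed)

theorem acc_recv (t : ℕ) (i : Fin n) :
    (acceleratedGradient n d L μ).recv f (noCompression n d) c ξ t i =
      gradient (f i) ((acceleratedGradient n d L μ).sent f (noCompression n d) c ξ t) := by
  rw [Algorithm.recv]
  rfl

theorem acc_avgHistory (t : ℕ) :
    accState L μ (avgHistory fun (r : Fin t) (j : Fin n) =>
      (acceleratedGradient n d L μ).recv f (noCompression n d) c ξ r j) t =
    accState L μ (fun k => avgGrad f
      ((acceleratedGradient n d L μ).sent f (noCompression n d) c ξ k)) t := by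
  refine accState_congr L μ t fun k hk => ?_
  simp only [avgHistory, dif_pos hk, acc_recv]
  rfl

theorem acc_sent (t : ℕ) :
    (acceleratedGradient n d L μ).sent f (noCompression n d) c ξ t =
      accQuery L μ t (accState L μ (fun k => avgGrad f
        ((acceleratedGradient n d L μ).sent f (noCompression n d) c ξ k)) t) := by
  rw [← acc_avgHistory]
  rfl

theorem acc_out (t : ℕ) :
    (acceleratedGradient n d L μ).out f (noCompression n d) c ξ t =
      (accState L μ (fun k => avgGrad f
        ((acceleratedGradient n d L μ).sent f (noCompression n d) c ξ k)) t).1 := by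
  rw [← acc_avgHistory]
  rfl

theorem accQuery_mem {V : Submodule ℝ (E d)} {p : E d × E d} (h1 : p.1 ∈ V) (h2 : p.2 ∈ V)
    (k : ℕ) : accQuery L μ k p ∈ V :=
  V.smul_mem _ (V.add_mem (V.smul_mem _ h1) (V.smul_mem _ h2))

theorem accState_mem {V : Submodule ℝ (E d)} {G : ℕ → E d} (t : ℕ) (hG : ∀ k < t, G k ∈ V) :
    (accState L μ G t).1 ∈ V ∧ (accState L μ G t).2 ∈ V := by
  induction t with
  | zero => exact ⟨V.zero_mem, V.zero_mem⟩
  | succ t ih =>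
    obtain ⟨h1, h2⟩ := ih fun k hk => hG k (by omega)
    have h3 : accQuery L μ t (accState L μ G t) ∈ V := accQuery_mem h1 h2 t
    have h4 := hG t (by omega)
    exact ⟨V.sub_mem h3 (V.smul_mem _ h4), V.smul_mem _ (V.sub_mem
      (V.add_mem (V.smul_mem _ h2) (V.smul_mem _ h3)) (V.smul_mem _ h4))⟩

theorem acceleratedGradient_linearSpanning :
    (acceleratedGradient n d L μ).LinearSpanning f (noCompression n d) := by
  have hmem : ∀ (c : (acceleratedGradient n d L μ).Coin) (ξ : ℕ → (noCompression n d).Seed)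
      (t k : ℕ), k < t → avgGrad f
        ((acceleratedGradient n d L μ).sent f (noCompression n d) c ξ k) ∈ Submodule.span ℝ
      ({x | ∃ r < t, x = (acceleratedGradient n d L μ).sent f (noCompression n d) c ξ r} ∪
        {x | ∃ r < t, ∃ i, x =
          (acceleratedGradient n d L μ).recv f (noCompression n d) c ξ r i}) := by
    intro c ξ t k hk
    refine Submodule.smul_mem _ _ (Submodule.sum_mem _ fun i _ => Submodule.subset_span ?_)
    exact Or.inr ⟨k, hk, i, (acc_recv f c ξ k i).symm⟩
  refine ⟨fun c ξ t => ?_, fun c ξ t i => ?_, fun c ξ t i => ?_, fun c ξ t => ?_⟩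
  · rw [acc_sent]
    have := accState_mem (L := L) (μ := μ) t (hmem c ξ t)
    exact accQuery_mem this.1 this.2 t
  · rintro _ rfl
    exact Submodule.subset_span (Or.inl (Or.inl ⟨t, le_rfl, rfl⟩))
  · refine Submodule.subset_span (Or.inl (Or.inr ⟨t, le_rfl,
      (acceleratedGradient n d L μ).sent f (noCompression n d) c ξ t, ?_, rfl⟩))
    exact Set.mem_singleton _
  · rw [acc_out]
    exact (accState_mem t (hmem c ξ t)).1

variable {f}

theorem InClass.acc_potential {Δ : ℝ} (h : InClass L μ Δ f) (hn : 1 ≤ n) (hL : 0 < L)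
    (hμ : 0 ≤ μ) {G x : ℕ → E d} (hx : ∀ k, x k = accQuery L μ k (accState L μ G k))
    (hG : ∀ k, G k = avgGrad f (x k)) (xs : E d) (t : ℕ) :
    accWeight L μ t ^ 2 * (avg f (accState L μ G t).1 - avg f xs) +
      (1 + μ * accWeight L μ t ^ 2) / 2 * ‖(accState L μ G t).2 - xs‖ ^ 2 ≤
        1 / 2 * ‖(0 : E d) - xs‖ ^ 2 := by
  induction t with
  | zero => simp [accWeight, accState]
  | succ t ih =>
    refine le_trans ?_ ih
    have hpos := accWeight_succ_pos hL hμ t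
    have hle : accWeight L μ t ^ 2 ≤ accWeight L μ (t + 1) ^ 2 :=
      pow_le_pow_left₀ (accWeight_nonneg t) (accWeight_le_succ t) 2
    have hstep := accWeight_step hL hμ t
    set S := accWeight L μ t
    set S' := accWeight L μ (t + 1)
    have hst1 : (accState L μ G (t + 1)).1 = x t - L⁻¹ • G t := by rw [hx]; rfl
    have hst2 : (accState L μ G (t + 1)).2 = (1 + μ * S' ^ 2)⁻¹ •
        ((1 + μ * S ^ 2) • (accState L μ G t).2 + (μ * (S' ^ 2 - S ^ 2)) • x t -
          (S' ^ 2 - S ^ 2) • G t) := by rw [hx]; rfl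
    -- The curvature `B = 1 + μ S²` is kept in step with the weight `A = S²`, so the step maps the
    -- potential to itself with `S'` for `S`.
    have key := accelerated_step (x := x t) (y := (accState L μ G t).1)
      (z := (accState L μ G t).2) (z' := (accState L μ G (t + 1)).2) (xs := xs) (g := G t)
      (L := L) (μ := μ) (A := S ^ 2) (B := 1 + μ * S ^ 2) (a := S' ^ 2 - S ^ 2)
      (fx := avg f (x t)) (fy := avg f (accState L μ G t).1)
      (fy' := avg f (accState L μ G (t + 1)).1) (fs := avg f xs) hL hμ (by positivity)
      (by linarith) (by positivity) ?_ ?_ ?_ ?_ ?_ ?_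
    · have e1 : S ^ 2 + (S' ^ 2 - S ^ 2) = S' ^ 2 := by ring
      have e2 : 1 + μ * S ^ 2 + μ * (S' ^ 2 - S ^ 2) = 1 + μ * S' ^ 2 := by ring
      rwa [e1, e2] at key
    · have := h.avg_upper hn (x t) (x t - L⁻¹ • G t)
      rw [← hG, sub_sub_cancel_left, inner_neg_right, inner_smul_right, norm_neg, norm_smul,
        real_inner_self_eq_norm_sq, mul_pow, Real.norm_eq_abs, sq_abs] at this
      rw [hst1]
      have e : L / 2 * (L⁻¹ ^ 2 * ‖G t‖ ^ 2) = ‖G t‖ ^ 2 / (2 * L) := by field_simp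
      have e' : L⁻¹ * ‖G t‖ ^ 2 = 2 * (‖G t‖ ^ 2 / (2 * L)) := by field_simp
      linarith
    · have := h.avg_lower hn (x t) (accState L μ G t).1
      rw [← hG] at this
      have h0 : 0 ≤ μ / 2 * ‖(accState L μ G t).1 - x t‖ ^ 2 := by positivity
      linarith
    · have := h.avg_lower hn (x t) xs
      rw [← hG] at this
      linarith
    · have : x t = (S' ^ 2)⁻¹ • (S ^ 2 • (accState L μ G t).1 +
          (S' ^ 2 - S ^ 2) • (accState L μ G t).2) := by rw [hx]; rfl
      rw [show S ^ 2 + (S' ^ 2 - S ^ 2) = S' ^ 2 by ring, this, smul_smul,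
        mul_inv_cancel₀ (by positivity), one_smul]
    · rw [hst2, show 1 + μ * S ^ 2 + μ * (S' ^ 2 - S ^ 2) = 1 + μ * S' ^ 2 by ring, smul_smul,
        mul_inv_cancel₀ (by positivity), one_smul]
    · rwa [show S ^ 2 + (S' ^ 2 - S ^ 2) = S' ^ 2 by ring]

theorem InClass.acc_rounds_le {Δ ε : ℝ} (h : InClass L μ Δ f) (hn : 1 ≤ n) (hL : 0 < L)
    (hμ : 0 ≤ μ) {t : ℕ} (ht : Δ ≤ 2 * ε * accWeight L μ t ^ 2)
    (hpos : 0 < accWeight L μ t) :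
    (acceleratedGradient n d L μ).rounds f (noCompression n d) ε ≤ t := by
  obtain ⟨xs, hxs, hΔ⟩ := h.minimizer
  refine iInf₂_le t ?_
  calc (acceleratedGradient n d L μ).expectedGap f (noCompression n d) t
      ≤ ∫⁻ _p, ENNReal.ofReal ε ∂((acceleratedGradient n d L μ).coinLaw.prod
          (Measure.infinitePi fun _ : ℕ => (noCompression n d).law)) := by
        refine lintegral_mono fun p => ENNReal.ofReal_le_ofReal ?_
        rw [iInf_avg_eq hxs, acc_out]
        have key := h.acc_potential hn hL hμ (acc_sent f p.1 p.2) (fun _ => rfl) xs t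
        set y := (accState L μ (fun k => avgGrad f
          ((acceleratedGradient n d L μ).sent f (noCompression n d) p.1 p.2 k)) t)
        have h0 : 0 ≤ (1 + μ * accWeight L μ t ^ 2) / 2 * ‖y.2 - xs‖ ^ 2 := by positivity
        have h1 : accWeight L μ t ^ 2 * (avg f y.1 - avg f xs) ≤ accWeight L μ t ^ 2 * ε := by
          linarith
        exact le_of_mul_le_mul_left h1 (by positivity)
    _ = ENNReal.ofReal ε := by simp

theorem InClass.acc_tcc_le {Δ ε K : ℝ} (h : InClass L μ Δ f) (hn : 1 ≤ n) (hL : 0 < L)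
    (hμ : 0 ≤ μ) {t : ℕ} (ht : Δ ≤ 2 * ε * accWeight L μ t ^ 2)
    (hpos : 0 < accWeight L μ t) (hK : t ≤ K) (r : ℕ) :
    (acceleratedGradient n d L μ).tcc f (noCompression n d) r ε ≤
      ENNReal.ofReal (r * d * K) := by
  calc (acceleratedGradient n d L μ).tcc f (noCompression n d) r ε
      ≤ ((r * d : ℕ) : ℝ≥0∞) * ((t : ℕ) : ℝ≥0∞) := by
        refine mul_le_mul' ?_ ?_
        · exact_mod_cast ENat.toENNReal_le.mpr (perRoundCost_noCompression_le n d r)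
        · exact_mod_cast ENat.toENNReal_le.mpr (h.acc_rounds_le hn hL hμ ht hpos)
    _ = ENNReal.ofReal (r * d * t) := by
        rw [ENNReal.ofReal_mul (by positivity), ENNReal.ofReal_natCast]
        congr 1
        rw [← ENNReal.ofReal_natCast]
        push_cast; rfl
    _ ≤ _ := by gcongr

end Run

theorem acc_tcc_strongly_convex {n d : ℕ} {L μ Δ : ℝ} {f : Fin n → E d → ℝ} (hn : 1 ≤ n)
    (hμ : 0 < μ) (hLμ : μ ≤ L) (h : InClass L μ Δ f) {ε : ℝ} (r : ℕ) (hε : 0 < ε)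
    (hεΔ : ε ≤ Real.exp (-1) * (μ * Δ)) :
    (acceleratedGradient n d L μ).tcc f (noCompression n d) r ε ≤
      ENNReal.ofReal (8 * (r * d * (√(L / μ) * Real.log (μ * Δ / ε)))) := by
  have hL : 0 < L := hμ.trans_le hLμ
  have hμΔ : 0 < μ * Δ := by
    by_contra hcon
    push Not at hcon
    have : Real.exp (-1) * (μ * Δ) ≤ 0 := mul_nonpos_of_nonneg_of_nonpos (Real.exp_pos _).le hcon
    linarith
  set κ := L / μ with hκ
  have hκ1 : 1 ≤ √κ := by
    rw [Real.one_le_sqrt, hκ, le_div_iff₀ hμ]; linarith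
  set lg := Real.log (μ * Δ / ε) with hlg
  have hlg1 : 1 ≤ lg := by
    rw [hlg, Real.le_log_iff_exp_le (by positivity), le_div_iff₀ hε]
    have := mul_le_mul_of_nonneg_left hεΔ (Real.exp_pos 1).le
    rwa [← mul_assoc, ← Real.exp_add, add_neg_cancel, Real.exp_zero, one_mul] at this
  -- The linear phase: `j` rounds bring the squared weight to `1/(4μ)`.
  set j := ⌈√κ⌉₊
  -- The geometric phase: `log ρ ≥ 1/(3√κ)`, so the squared weight grows by a factor of at least `e
  -- μΔ/ε`. The extra `1` next to `lg` supplies `e ≥ 2`, which makes up for the `1/4` of the linear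
  -- phase.
  set k := ⌈3 / 2 * √κ * (lg + 1)⌉₊
  have hj : √κ ≤ j := Nat.le_ceil _
  have hk : 3 / 2 * √κ * (lg + 1) ≤ k := Nat.le_ceil _
  have hj2 : (j : ℝ) ≤ √κ + 1 := (Nat.ceil_lt_add_one (by positivity)).le
  have hk2 : (k : ℝ) ≤ 3 / 2 * √κ * (lg + 1) + 1 := (Nat.ceil_lt_add_one (by positivity)).le
  have hSj : 1 / (4 * μ) ≤ accWeight L μ j ^ 2 := by
    have h1 : 1 / (2 * √μ) ≤ accWeight L μ j := by
      refine le_trans ?_ (accWeight_linear hL hμ.le j)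
      have h2 : √κ * √μ = √L := by
        rw [← Real.sqrt_mul (by positivity), hκ, div_mul_cancel₀ _ hμ.ne']
      have h3 : 0 < √L := Real.sqrt_pos.mpr hL
      have h4 : 0 < √μ := Real.sqrt_pos.mpr hμ
      rw [div_le_div_iff₀ (by positivity) (by positivity)]
      nlinarith
    have h5 := pow_le_pow_left₀ (by positivity) h1 2
    rw [div_pow, mul_pow, Real.sq_sqrt hμ.le] at h5
    norm_num at h5 ⊢
    exact h5
  have hx : √(μ / L) = 1 / √κ := by
    rw [hκ, one_div, ← Real.sqrt_inv, inv_div]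
  set ρ := 1 + √(μ / L) / 2 with hρ
  have hρ1 : 2 / (3 * √κ) ≤ 2 * Real.log ρ := by
    have h1 := Real.one_sub_inv_le_log_of_pos (show 0 < ρ by positivity)
    have h2 : 1 / (3 * √κ) ≤ 1 - ρ⁻¹ := by
      have e : 1 - ρ⁻¹ = 1 / (2 * √κ + 1) := by
        rw [hρ, hx]; field_simp; ring
      rw [e]
      gcongr
      linarith
    have e : 2 / (3 * √κ) = 2 * (1 / (3 * √κ)) := by ring
    linarith
  have hgeo : Real.exp 1 * (μ * Δ / ε) ≤ (ρ ^ k) ^ 2 := by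
    rw [← Real.exp_log (show 0 < μ * Δ / ε by positivity), ← Real.exp_add,
      ← Real.exp_log (show 0 < (ρ ^ k) ^ 2 by positivity), Real.log_pow, Real.log_pow,
      Real.exp_le_exp]
    push_cast
    have h1 := mul_le_mul_of_nonneg_left hρ1 (Nat.cast_nonneg (α := ℝ) k)
    have h2 : lg + 1 ≤ k * (2 / (3 * √κ)) := by
      have := mul_le_mul_of_nonneg_right hk (show 0 ≤ 2 / (3 * √κ) by positivity)
      refine le_trans (le_of_eq ?_) this
      field_simp
    linarith
  have hS := accWeight_geometric hL hμ.le j k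
  have hSnn := accWeight_nonneg (L := L) (μ := μ) j
  have hS2 := pow_le_pow_left₀ (by positivity) hS 2
  rw [mul_pow] at hS2
  have hexp : 2 ≤ Real.exp 1 := by linarith [Real.add_one_le_exp 1]
  have hfinal : Δ ≤ 2 * ε * accWeight L μ (j + k) ^ 2 := by
    have h1 : 1 / (4 * μ) * (2 * (μ * Δ / ε)) ≤ accWeight L μ (j + k) ^ 2 := by
      refine le_trans ?_ hS2
      gcongr
      refine le_trans ?_ hgeo
      gcongr
    have h2 := mul_le_mul_of_nonneg_left h1 (show 0 ≤ 2 * ε by positivity)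
    refine le_trans (le_of_eq ?_) h2
    field_simp
    norm_num
  have hspos : 0 < accWeight L μ (j + k) := by
    refine (accWeight_nonneg _).lt_of_ne fun h0 => ?_
    rw [← h0] at hfinal
    have : 0 < Δ := (pos_iff_pos_of_mul_pos hμΔ).mp hμ
    norm_num at hfinal
    linarith
  refine (h.acc_tcc_le hn hL hμ.le hfinal hspos (K := 8 * (√κ * lg)) ?_ r).trans
    (le_of_eq (by congr 1; ring))
  push_cast
  nlinarith [mul_le_mul hκ1 hlg1 zero_le_one (by positivity)]

theorem acc_tcc_convex {n d : ℕ} {L Δ : ℝ} {f : Fin n → E d → ℝ} (hn : 1 ≤ n)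
    (hL : 0 < L) (h : InClass L 0 Δ f) {ε : ℝ} (r : ℕ) (hε : 0 < ε)
    (hεΔ : ε ≤ Real.exp (-1) * (L * Δ)) :
    (acceleratedGradient n d L 0).tcc f (noCompression n d) r ε ≤
      ENNReal.ofReal (8 * (r * d * √(L * Δ / ε))) := by
  have hLΔ : ε ≤ L * Δ := by
    have : Real.exp (-1) ≤ 1 := Real.exp_le_one_iff.mpr (by norm_num)
    by_cases h0 : 0 ≤ L * Δ
    · nlinarith
    · nlinarith [Real.exp_pos (-1)]
  set w := √(L * Δ / ε) with hw
  have hw1 : 1 ≤ w := by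
    rw [hw, Real.one_le_sqrt, le_div_iff₀ hε]; linarith
  -- For `μ = 0` the linear growth of the weights alone suffices.
  set t := ⌈2 * w⌉₊
  have ht : 2 * w ≤ t := Nat.le_ceil _
  have ht2 : (t : ℝ) ≤ 2 * w + 1 := (Nat.ceil_lt_add_one (by positivity)).le
  have hsqL : 0 < √L := Real.sqrt_pos.mpr hL
  have hS : w / √L ≤ accWeight L 0 t := by
    refine le_trans ?_ (accWeight_linear hL le_rfl t)
    rw [div_le_div_iff₀ (by positivity) (by positivity)]
    nlinarith
  have hS2 := pow_le_pow_left₀ (by positivity) hS 2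
  rw [div_pow, Real.sq_sqrt hL.le, hw, Real.sq_sqrt (div_nonneg (by linarith) hε.le)] at hS2
  have hΔ : 0 ≤ Δ := (pos_iff_pos_of_mul_pos (hε.trans_le hLΔ)).mp hL |>.le
  refine (h.acc_tcc_le hn hL le_rfl (t := t) ?_ (lt_of_lt_of_le (by positivity) hS)
    (K := 8 * w) (by linarith) r).trans (le_of_eq (by congr 1; ring))
  have h2 := mul_le_mul_of_nonneg_left hS2 (show 0 ≤ 2 * ε by positivity)
  have e : 2 * ε * (L * Δ / ε / L) = 2 * Δ := by field_simp
  linarith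

/-! ### Quadratic functions on a chain of coordinates -/

section Chain

variable {d : ℕ}

/-- The linear form of this vector is `x ↦ x_{j-1} - x_j`, where entries outside the range
`0, …, d - 1` are read as `0`. -/
def linkVec (d j : ℕ) : E d :=
  WithLp.toLp 2 fun k => (if (k : ℕ) + 1 = j then 1 else 0) - (if (k : ℕ) = j then 1 else 0)

/-- The entries of `x`, shifted by one and extended by `0`. -/
def shiftExt (x : E d) (j : ℕ) : ℝ := ∑ k : Fin d, if (k : ℕ) + 1 = j then x k else 0

theorem shiftExt_zero (x : E d) : shiftExt x 0 = 0 := by simp [shiftExt]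

theorem shiftExt_succ (x : E d) (k : Fin d) : shiftExt x (k + 1) = x k := by
  simp [shiftExt, ← Fin.ext_iff]

theorem shiftExt_succ_of_le (x : E d) {k : ℕ} (hk : d ≤ k) : shiftExt x (k + 1) = 0 :=
  Finset.sum_eq_zero fun l _ => if_neg (by have := l.isLt; omega)

theorem inner_linkVec (x : E d) (j : ℕ) :
    inner ℝ (linkVec d j) x = shiftExt x j - shiftExt x (j + 1) := by
  simp [linkVec, shiftExt, PiLp.inner_apply, mul_sub, Finset.sum_sub_distrib]

theorem sum_shiftExt_sq (x : E d) : ∑ j ∈ Finset.range (d + 2), shiftExt x j ^ 2 = ‖x‖ ^ 2 := by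
  rw [Finset.sum_range_succ, shiftExt_succ_of_le x le_rfl, Finset.sum_range_succ', shiftExt_zero,
    EuclideanSpace.real_norm_sq_eq, Finset.sum_range]
  simp [shiftExt_succ]

/-- The links of equal parity involve disjoint pairs of coordinates. -/
theorem sum_inner_linkVec_sq_le (x : E d) (p : ℕ) :
    ∑ j ∈ Finset.range (d + 1), (if j % 2 = p then inner ℝ (linkVec d j) x ^ 2 else 0) ≤
      2 * ‖x‖ ^ 2 := by
  -- `g` holds the left ends of the links of parity `p` and `g'` the right ends; together they use
  -- every entry once, and the factor 2 comes from `(u - v)² ≤ 2u² + 2v²`.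
  let g : ℕ → ℝ := fun j => if j % 2 = p then shiftExt x j ^ 2 else 0
  let g' : ℕ → ℝ := fun j => if j % 2 = p then 0 else shiftExt x j ^ 2
  have hg : ∀ j, 0 ≤ g j := fun j => by dsimp only [g]; split_ifs <;> positivity
  have hg' : ∀ j, 0 ≤ g' j := fun j => by dsimp only [g']; split_ifs <;> positivity
  have h1 : ∀ j, (if j % 2 = p then inner ℝ (linkVec d j) x ^ 2 else 0) ≤
      2 * (g j + g' (j + 1)) := by
    intro j
    split_ifs with h
    · have h2 : ¬ (j + 1) % 2 = p := by omega
      simp only [g, g', if_pos h, if_neg h2, inner_linkVec]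
      nlinarith [sq_nonneg (shiftExt x j + shiftExt x (j + 1))]
    · have := hg j
      have := hg' (j + 1)
      positivity
  have h3 : ∑ j ∈ Finset.range (d + 1), g j ≤ ∑ j ∈ Finset.range (d + 2), g j := by
    rw [Finset.sum_range_succ _ (d + 1)]; linarith [hg (d + 1)]
  have h4 : ∑ j ∈ Finset.range (d + 1), g' (j + 1) ≤ ∑ j ∈ Finset.range (d + 2), g' j := by
    rw [Finset.sum_range_succ' _ (d + 1)]; linarith [hg' 0]
  have h5 : ∑ j ∈ Finset.range (d + 2), g j + ∑ j ∈ Finset.range (d + 2), g' j = ‖x‖ ^ 2 := by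
    rw [← Finset.sum_add_distrib, ← sum_shiftExt_sq]
    refine Finset.sum_congr rfl fun j _ => ?_
    simp only [g, g']
    split_ifs <;> simp
  calc _ ≤ ∑ j ∈ Finset.range (d + 1), 2 * (g j + g' (j + 1)) :=
        Finset.sum_le_sum fun j _ => h1 j
    _ = 2 * (∑ j ∈ Finset.range (d + 1), g j + ∑ j ∈ Finset.range (d + 1), g' (j + 1)) := by
        rw [← Finset.mul_sum, Finset.sum_add_distrib]
    _ ≤ _ := by linarith

/-- The quadratic function with weight `c j` on the link `x_{j-1} - x_j`, where `x_{-1} = a`. -/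
def chainQuad (μ a : ℝ) (c : ℕ → ℝ) (x : E d) : ℝ :=
  μ / 2 * ‖x‖ ^ 2 + 1 / 2 * ∑ j ∈ Finset.range (d + 1),
    c j * (inner ℝ (linkVec d j) x + if j = 0 then a else 0) ^ 2

/-- The gradient of `chainQuad`. -/
def chainGrad (μ a : ℝ) (c : ℕ → ℝ) (x : E d) : E d :=
  μ • x + ∑ j ∈ Finset.range (d + 1),
    (c j * (inner ℝ (linkVec d j) x + if j = 0 then a else 0)) • linkVec d j

/-- An exact second-order expansion. The gradient formula, both curvature bounds and the growth
around the minimizer are read off from it. -/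
theorem chainQuad_sub (μ a : ℝ) (c : ℕ → ℝ) (x y : E d) :
    chainQuad μ a c y - chainQuad μ a c x - inner ℝ (chainGrad μ a c x) (y - x) =
      μ / 2 * ‖y - x‖ ^ 2 +
        1 / 2 * ∑ j ∈ Finset.range (d + 1), c j * inner ℝ (linkVec d j) (y - x) ^ 2 := by
  have h1 : μ / 2 * ‖y‖ ^ 2 - μ / 2 * ‖x‖ ^ 2 - μ * inner ℝ x (y - x) =
      μ / 2 * ‖y - x‖ ^ 2 := by
    rw [norm_sub_sq_real, inner_sub_right, real_inner_self_eq_norm_sq, real_inner_comm y x]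
    ring
  have h2 : 1 / 2 * ∑ j ∈ Finset.range (d + 1),
        c j * (inner ℝ (linkVec d j) y + if j = 0 then a else 0) ^ 2 -
      1 / 2 * ∑ j ∈ Finset.range (d + 1),
        c j * (inner ℝ (linkVec d j) x + if j = 0 then a else 0) ^ 2 -
      ∑ j ∈ Finset.range (d + 1), (c j * (inner ℝ (linkVec d j) x + if j = 0 then a else 0)) *
        inner ℝ (linkVec d j) (y - x) =
      1 / 2 * ∑ j ∈ Finset.range (d + 1), c j * inner ℝ (linkVec d j) (y - x) ^ 2 := by
    simp only [Finset.mul_sum]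
    rw [← Finset.sum_sub_distrib, ← Finset.sum_sub_distrib]
    refine Finset.sum_congr rfl fun j _ => ?_
    rw [inner_sub_right]
    ring
  rw [← h1, ← h2, chainQuad, chainQuad, chainGrad, inner_add_left, real_inner_smul_left,
    sum_inner]
  simp only [real_inner_smul_left]
  ring

theorem hasGradientAt_chainQuad (μ a : ℝ) (c : ℕ → ℝ) (x : E d) :
    HasGradientAt (chainQuad μ a c) (chainGrad μ a c x) x := by
  rw [hasGradientAt_iff_isLittleO]
  have h1 : ∀ y, chainQuad μ a c y - chainQuad μ a c x - inner ℝ (chainGrad μ a c x) (y - x) =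
      μ / 2 * ‖y - x‖ ^ 2 +
        1 / 2 * ∑ j ∈ Finset.range (d + 1), c j * inner ℝ (linkVec d j) (y - x) ^ 2 :=
    chainQuad_sub μ a c x
  have hbig : (fun y => chainQuad μ a c y - chainQuad μ a c x -
      inner ℝ (chainGrad μ a c x) (y - x)) =O[nhds x] fun y => ‖y - x‖ ^ 2 := by
    simp_rw [h1]
    refine ((Asymptotics.isBigO_refl _ _).const_mul_left _).add
      ((Asymptotics.IsBigO.fun_sum fun j _ => ?_).const_mul_left _)
    refine Asymptotics.IsBigO.const_mul_left (Asymptotics.IsBigO.of_bound (‖linkVec d j‖ ^ 2)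
      (Filter.Eventually.of_forall fun y => ?_)) _
    rw [norm_pow, norm_pow, norm_norm, ← mul_pow]
    exact pow_le_pow_left₀ (norm_nonneg _) (norm_inner_le_norm _ _) 2
  refine hbig.trans_isLittleO ?_
  have h2 : (fun y : E d => ‖y - x‖ ^ 2) =o[nhds x] fun y => ‖y - x‖ ^ 1 :=
    (Asymptotics.isLittleO_pow_pow one_lt_two).comp_tendsto (by
      have : Filter.Tendsto (fun y : E d => ‖y - x‖) (nhds x) (nhds ‖x - x‖) :=
        (by fun_prop : Continuous fun y : E d => ‖y - x‖).tendsto x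
      simpa using this)
  simp_rw [pow_one] at h2
  exact h2.of_norm_right

/-- The space of the vectors whose entries vanish from the `k`-th on. -/
def prefixSpace (d k : ℕ) : Submodule ℝ (E d) where
  carrier := {x | ∀ j : Fin d, k ≤ j → x j = 0}
  zero_mem' := fun _ _ => rfl
  add_mem' := fun hx hy j hj => by simp [hx j hj, hy j hj]
  smul_mem' := fun c x hx j hj => by simp [hx j hj]

theorem prefixSpace_mono {k l : ℕ} (h : k ≤ l) : prefixSpace d k ≤ prefixSpace d l :=
  fun _ hx j hj => hx j (h.trans hj)

theorem shiftExt_eq_zero {k : ℕ} {x : E d} (hx : x ∈ prefixSpace d k) {j : ℕ} (hj : k < j) :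
    shiftExt x j = 0 :=
  Finset.sum_eq_zero fun l _ => by
    split_ifs with h
    · exact hx l (by omega)
    · rfl

theorem linkVec_mem {j k : ℕ} (h : j < k) : linkVec d j ∈ prefixSpace d k := by
  intro l hl
  simp only [linkVec]
  rw [if_neg (by omega), if_neg (by omega), sub_zero]

/-- The prefix of coordinates that a worker with the links of parity `p` reaches from the first
`k` coordinates. -/
def reach (p k : ℕ) : ℕ := if k % 2 = p then k + 1 else k

theorem le_reach (p k : ℕ) : k ≤ reach p k := by unfold reach; split_ifs <;> omega

theorem reach_le (p k : ℕ) : reach p k ≤ k + 1 := by unfold reach; split_ifs <;> omega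

/-- After one new coordinate the next link has the other parity. Therefore further local gradient
steps within a round gain nothing. -/
theorem reach_reach (p k : ℕ) : reach p (reach p k) = reach p k := by
  unfold reach; split_ifs <;> omega

theorem reach_mono (p : ℕ) {k l : ℕ} (h : k ≤ l) : reach p k ≤ reach p l := by
  unfold reach; split_ifs <;> omega

/-- Links `j > k` vanish on `x`, links `j < k` stay within the prefix, and only link `k` touches
coordinate `k`; the worker owns it only if `k` has parity `p`. -/
theorem chainGrad_mem {μ a : ℝ} {c : ℕ → ℝ} {p k : ℕ} (hc : ∀ j, j % 2 ≠ p → c j = 0) {x : E d}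
    (hx : x ∈ prefixSpace d k) : chainGrad μ a c x ∈ prefixSpace d (reach p k) := by
  refine Submodule.add_mem _ (Submodule.smul_mem _ _ (prefixSpace_mono (le_reach p k) hx))
    (Submodule.sum_mem _ fun j _ => ?_)
  by_cases hjk : j < reach p k
  · exact Submodule.smul_mem _ _ (linkVec_mem hjk)
  · have hzero : c j * (inner ℝ (linkVec d j) x + if j = 0 then a else 0) = 0 := by
      by_cases hj : j % 2 = p
      · have hkj : k < j := by
          by_contra hcon
          unfold reach at hjk
          split_ifs at hjk with h
          · omega
          · have : j = k := by omega
            exact h (this ▸ hj)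
        rw [inner_linkVec, shiftExt_eq_zero hx hkj, shiftExt_eq_zero hx (hkj.trans j.lt_succ_self),
          if_neg (by omega)]
        simp
      · rw [hc j hj, zero_mul]
    rw [hzero, zero_smul]
    exact Submodule.zero_mem _

end Chain

/-! ### The hard instance -/

section Hard

/-- The number of `i < n` with `i % 2 = p`, for `p < 2`. -/
theorem sum_parity (n : ℕ) {p : ℕ} (hp : p < 2) :
    ∑ i : Fin n, (if (i : ℕ) % 2 = p then 1 else 0) = (n + 1 - p) / 2 := by
  rw [Fin.sum_univ_eq_sum_range (fun i => if i % 2 = p then 1 else 0) n]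
  induction n with
  | zero => simp; omega
  | succ n ih =>
    rw [Finset.sum_range_succ, ih]
    split_ifs <;> omega

/-- The weight of the workers with parity `p` among `n`: their number times it is `n / 2`. -/
def groupWeight (n p : ℕ) : ℝ := n / (2 * ((n + 1 - p) / 2 : ℕ))

theorem groupWeight_nonneg (n p : ℕ) : 0 ≤ groupWeight n p := by unfold groupWeight; positivity

theorem groupWeight_le {n p : ℕ} (hn : 2 ≤ n) (hp : p < 2) : groupWeight n p ≤ 3 / 2 := by
  unfold groupWeight
  have h1 : 0 < (n + 1 - p) / 2 := by omega
  -- The extreme case is `n = 3`, `p = 1`, with a single odd worker.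
  have h2 : n ≤ 3 * ((n + 1 - p) / 2) := by omega
  have h3 : (n : ℝ) ≤ 3 * ((n + 1 - p) / 2 : ℕ) := by exact_mod_cast h2
  rw [div_le_div_iff₀ (by positivity) two_pos]
  linarith

variable {n d : ℕ}

/-- The weights of the links for the workers of parity `p`. -/
def chainWeight (n d : ℕ) (β q : ℝ) (p j : ℕ) : ℝ :=
  if j % 2 = p then groupWeight n p * (β * if j = d then 1 - q else 1) else 0

/-- The local functions of the hard instance. -/
def hardFun (n d : ℕ) (μ a β q : ℝ) (i : Fin n) : E d → ℝ :=
  chainQuad μ a (chainWeight n d β q (i % 2))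

variable {μ a β q : ℝ}

theorem avg_chainWeight (hn : 2 ≤ n) (j : ℕ) :
    (1 / (n : ℝ)) * ∑ i : Fin n, chainWeight n d β q (i % 2) j =
      β / 2 * if j = d then 1 - q else 1 := by
  have hp : j % 2 < 2 := Nat.mod_lt _ two_pos
  have h1 : ∀ i : Fin n, chainWeight n d β q (i % 2) j =
      (if (i : ℕ) % 2 = j % 2 then 1 else 0 : ℕ) *
        (groupWeight n (j % 2) * (β * if j = d then 1 - q else 1)) := by
    intro i
    unfold chainWeight
    by_cases h : j % 2 = i % 2
    · rw [if_pos h, if_pos h.symm, h]; simp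
    · rw [if_neg h, if_neg (Ne.symm h)]; simp
  simp_rw [h1]
  rw [← Finset.sum_mul, ← Nat.cast_sum, sum_parity n hp, groupWeight]
  have h2 : (((n + 1 - j % 2) / 2 : ℕ) : ℝ) ≠ 0 := by
    have : 0 < (n + 1 - j % 2) / 2 := by omega
    positivity
  have h3 : (n : ℝ) ≠ 0 := by positivity
  generalize (if j = d then 1 - q else 1) = e
  generalize (((n + 1 - j % 2) / 2 : ℕ) : ℝ) = N at h2
  field_simp

theorem avg_hardFun (hn : 2 ≤ n) (x : E d) :
    avg (hardFun n d μ a β q) x =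
      chainQuad μ a (fun j => β / 2 * if j = d then 1 - q else 1) x := by
  have h3 : (n : ℝ) ≠ 0 := by positivity
  simp only [avg, hardFun, chainQuad]
  rw [Finset.sum_add_distrib, mul_add, ← Finset.mul_sum, ← Finset.mul_sum, Finset.sum_comm]
  congr 1
  · rw [Finset.sum_const, Finset.card_univ, Fintype.card_fin, nsmul_eq_mul]
    field_simp
  · rw [mul_left_comm]
    congr 1
    rw [Finset.mul_sum]
    refine Finset.sum_congr rfl fun j _ => ?_
    rw [← avg_chainWeight hn j, ← Finset.sum_mul, mul_assoc]

theorem gradient_hardFun (i : Fin n) (x : E d) :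
    gradient (hardFun n d μ a β q i) x = chainGrad μ a (chainWeight n d β q (i % 2)) x :=
  (hasGradientAt_chainQuad μ a _ x).gradient

theorem gradient_hardFun_mem (i : Fin n) {k : ℕ} {x : E d} (hx : x ∈ prefixSpace d k) :
    gradient (hardFun n d μ a β q i) x ∈ prefixSpace d (reach (i % 2) k) := by
  rw [gradient_hardFun]
  exact chainGrad_mem (fun j hj => if_neg hj) hx

/-- The minimizer of the hard instance. -/
def hardMin (d : ℕ) (s q : ℝ) : E d := WithLp.toLp 2 fun k => s * q ^ (k : ℕ)

/-- With `x_{-1} = a` the entries continue as `a q^(j+1)`, so each difference is `a (1 - q) q^j`. At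
the last link the right end is `0` and the factor `1 - q` is missing; the special weight restores
it, so the geometric vector is an exact minimizer in finite dimension. -/
theorem link_hardMin {s : ℝ} (hs : s = a * q) {j : ℕ} (hj : j ∈ Finset.range (d + 1)) :
    (if j = d then 1 - q else 1) * (inner ℝ (linkVec d j) (hardMin d s q) +
      if j = 0 then a else 0) = a * (1 - q) * q ^ j := by
  have hjd : j ≤ d := Nat.lt_succ_iff.mp (Finset.mem_range.mp hj)
  have h1 : shiftExt (hardMin d s q) j + (if j = 0 then a else 0) = a * q ^ j := by
    rcases j with _ | k
    · simp [shiftExt_zero]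
    · have := shiftExt_succ (hardMin d s q) ⟨k, hjd⟩
      simp only at this
      rw [this, if_neg k.succ_ne_zero, hardMin, hs]
      simp only
      ring
  have h2 : inner ℝ (linkVec d j) (hardMin d s q) + (if j = 0 then a else 0) =
      a * q ^ j - shiftExt (hardMin d s q) (j + 1) := by
    rw [inner_linkVec, ← h1]; ring
  rw [h2]
  split_ifs with h
  · rw [shiftExt_succ_of_le _ h.ge]; ring
  · have := shiftExt_succ (hardMin d s q) ⟨j, by omega⟩
    simp only at this
    rw [this, hardMin, hs]
    simp only
    ring

theorem chainGrad_hardMin {s : ℝ} (hs : s = a * q) (hq : μ * q = β / 2 * (1 - q) ^ 2) :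
    chainGrad μ a (fun j => β / 2 * if j = d then 1 - q else 1) (hardMin d s q) = 0 := by
  have h1 : ∀ j ∈ Finset.range (d + 1), ((β / 2 * if j = d then 1 - q else 1) *
      (inner ℝ (linkVec d j) (hardMin d s q) + if j = 0 then a else 0)) • linkVec d j =
      (β / 2 * (a * (1 - q) * q ^ j)) • linkVec d j := by
    intro j hj
    rw [mul_assoc, link_hardMin hs hj]
  rw [chainGrad, Finset.sum_congr rfl h1]
  ext k
  have hk := k.isLt
  rw [PiLp.add_apply, WithLp.ofLp_sum, Finset.sum_apply]
  simp only [PiLp.smul_apply, linkVec, hardMin, smul_eq_mul, mul_sub, mul_ite, mul_one, mul_zero,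
    Finset.sum_sub_distrib, Finset.sum_ite_eq, PiLp.zero_apply]
  rw [if_pos (Finset.mem_range.mpr (by omega)), if_pos (Finset.mem_range.mpr (by omega)), hs]
  linear_combination a * q ^ (k : ℕ) * hq

theorem avg_hardFun_sub (hn : 2 ≤ n) (hβ : 0 ≤ β) (hq1 : q ≤ 1) {s : ℝ} (hs : s = a * q)
    (hq : μ * q = β / 2 * (1 - q) ^ 2) (y : E d) :
    μ / 2 * ‖y - hardMin d s q‖ ^ 2 ≤
      avg (hardFun n d μ a β q) y - avg (hardFun n d μ a β q) (hardMin d s q) := by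
  have h := chainQuad_sub μ a (fun j => β / 2 * if j = d then 1 - q else 1) (hardMin d s q) y
  rw [chainGrad_hardMin hs hq, inner_zero_left, sub_zero, ← avg_hardFun hn, ← avg_hardFun hn] at h
  rw [h]
  have : 0 ≤ ∑ j ∈ Finset.range (d + 1), (β / 2 * if j = d then 1 - q else 1) *
      inner ℝ (linkVec d j) (y - hardMin d s q) ^ 2 := by
    refine Finset.sum_nonneg fun j _ => mul_nonneg (mul_nonneg (by positivity) ?_) (sq_nonneg _)
    split_ifs <;> linarith
  linarith

/-- Link weights are at most `3β/2` and links of one parity contribute at most `2‖·‖²`, whence the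
`3β`. The normalization of `s` makes `‖x⋆‖² = Δ (1 - q^(2d)) ≤ Δ`. -/
theorem hardFun_inClass {L Δ : ℝ} (hn : 2 ≤ n) (hμ : 0 ≤ μ) (hβ : 0 ≤ β) (hL : μ + 3 * β ≤ L)
    (hq0 : 0 ≤ q) (hq1 : q < 1) {s : ℝ} (hs : s = a * q) (hq : μ * q = β / 2 * (1 - q) ^ 2)
    (hΔ : s ^ 2 = Δ * (1 - q ^ 2)) : InClass L μ Δ (hardFun n d μ a β q) where
  differentiable := fun i x => (hasGradientAt_chainQuad μ a _ x).differentiableAt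
  strong_convex := fun i x y => by
    rw [gradient_hardFun, hardFun, chainQuad_sub]
    have : 0 ≤ ∑ j ∈ Finset.range (d + 1), chainWeight n d β q (i % 2) j *
        inner ℝ (linkVec d j) (y - x) ^ 2 := by
      refine Finset.sum_nonneg fun j _ => mul_nonneg ?_ (sq_nonneg _)
      unfold chainWeight
      have hw := groupWeight_nonneg n (i % 2)
      split_ifs
      · have : 0 ≤ 1 - q := by linarith
        positivity
      · positivity
      · exact le_rfl
    linarith
  smooth := fun i x y => by
    rw [gradient_hardFun, hardFun, chainQuad_sub]
    have h1 : ∑ j ∈ Finset.range (d + 1), chainWeight n d β q (i % 2) j *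
        inner ℝ (linkVec d j) (y - x) ^ 2 ≤ ∑ j ∈ Finset.range (d + 1), 3 / 2 * β *
          (if j % 2 = i % 2 then inner ℝ (linkVec d j) (y - x) ^ 2 else 0) := by
      refine Finset.sum_le_sum fun j _ => ?_
      unfold chainWeight
      have hw := groupWeight_le hn (Nat.mod_lt i two_pos)
      have hw0 := groupWeight_nonneg n (i % 2)
      by_cases h : j % 2 = i % 2
      · rw [if_pos h, if_pos h]
        have he : β * (if j = d then 1 - q else 1) ≤ β := by
          refine mul_le_of_le_one_right hβ ?_
          split_ifs <;> linarith
        gcongr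
      · rw [if_neg h, if_neg h]; simp
    rw [← Finset.mul_sum] at h1
    have h2 := mul_le_mul_of_nonneg_left (sum_inner_linkVec_sq_le (y - x) (i % 2))
      (show 0 ≤ 3 / 2 * β by positivity)
    have h3 : (μ + 3 * β) * ‖y - x‖ ^ 2 ≤ L * ‖y - x‖ ^ 2 := by gcongr
    linarith
  minimizer := by
    refine ⟨hardMin d s q, fun y => ?_, ?_⟩
    · have := avg_hardFun_sub hn hβ hq1.le hs hq y
      have h0 : 0 ≤ μ / 2 * ‖y - hardMin d s q‖ ^ 2 := by positivity
      linarith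
    · rw [zero_sub, norm_neg, EuclideanSpace.real_norm_sq_eq]
      have h1 : ∀ k : Fin d, hardMin d s q k ^ 2 = Δ * ((1 - q ^ 2) * (q ^ 2) ^ (k : ℕ)) := by
        intro k
        rw [hardMin]
        simp only
        rw [mul_pow, hΔ]; ring
      simp_rw [h1]
      rw [← Finset.mul_sum, ← Finset.mul_sum,
        Fin.sum_univ_eq_sum_range (fun k => (q ^ 2) ^ k) d, mul_neg_geom_sum]
      have hΔ0 : 0 ≤ Δ := by
        have : 0 < 1 - q ^ 2 := by nlinarith
        by_contra hcon
        push Not at hcon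
        nlinarith [sq_nonneg s]
      have : 0 ≤ (q ^ 2) ^ d := by positivity
      nlinarith

/-- As an inequality it also covers `k > N`, where the left side is nonpositive; `progress` is not
capped at `d`, so that case does occur. -/
theorem geometric_tail {φ : ℝ} (h0 : 0 ≤ φ) (h1 : φ ≤ 1) (k N : ℕ) :
    φ ^ k - φ ^ N ≤ (1 - φ) * ∑ j ∈ Finset.range N, if k ≤ j then φ ^ j else 0 := by
  induction N with
  | zero => simpa using pow_le_one₀ h0 h1
  | succ N ih =>
    rw [Finset.sum_range_succ]
    split_ifs with h
    · rw [pow_succ]; linarith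
    · have h2 : φ ^ k ≤ φ ^ (N + 1) := pow_le_pow_of_le_one h0 h1 (by omega)
      have h3 : 0 ≤ (1 - φ) * ∑ j ∈ Finset.range N, (if k ≤ j then φ ^ j else 0) :=
        mul_nonneg (by linarith) (Finset.sum_nonneg fun j _ => by split_ifs <;> positivity)
      linarith

theorem hardFun_gap {Δ : ℝ} (hn : 2 ≤ n) (hμ : 0 ≤ μ) (hβ : 0 ≤ β)
    (hq0 : 0 ≤ q) (hq1 : q < 1) (hΔ0 : 0 ≤ Δ) {s : ℝ} (hs : s = a * q)
    (hq : μ * q = β / 2 * (1 - q) ^ 2) (hΔ : s ^ 2 = Δ * (1 - q ^ 2)) {k : ℕ} {y : E d}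
    (hy : y ∈ prefixSpace d k) :
    μ * Δ / 2 * ((q ^ 2) ^ k - (q ^ 2) ^ d) ≤
      avg (hardFun n d μ a β q) y - ⨅ x, avg (hardFun n d μ a β q) x := by
  have hmin : ∀ y, avg (hardFun n d μ a β q) (hardMin d s q) ≤ avg (hardFun n d μ a β q) y := by
    intro y
    have := avg_hardFun_sub hn hβ hq1.le hs hq y
    have h0 : 0 ≤ μ / 2 * ‖y - hardMin d s q‖ ^ 2 := by positivity
    linarith
  rw [iInf_avg_eq hmin]
  refine le_trans ?_ (avg_hardFun_sub hn hβ hq1.le hs hq y)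
  have h1 : Δ * ((1 - q ^ 2) * ∑ j ∈ Finset.range d, if k ≤ j then (q ^ 2) ^ j else 0) ≤
      ‖y - hardMin d s q‖ ^ 2 := by
    rw [EuclideanSpace.real_norm_sq_eq, ← mul_assoc, ← hΔ, Finset.mul_sum, Finset.sum_range]
    refine Finset.sum_le_sum fun j _ => ?_
    split_ifs with h
    · rw [PiLp.sub_apply, hy j h, hardMin]
      simp only
      exact le_of_eq (by ring)
    · rw [mul_zero]; positivity
  have h2 := mul_le_mul_of_nonneg_left
    (geometric_tail (sq_nonneg q) (by nlinarith : q ^ 2 ≤ 1) k d) hΔ0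
  have h3 := mul_le_mul_of_nonneg_left (h2.trans h1) (show 0 ≤ μ / 2 by positivity)
  linarith

end Hard

/-! ### Progress of the algorithms under random sparsification -/

/-- The number of coordinates that the server can have reached after `t` rounds: one more in each
round in which the residue class of the next coordinate is drawn. -/
def progress {m : ℕ} (ξ : ℕ → Fin m) : ℕ → ℕ
  | 0 => 0
  | t + 1 => if progress ξ t % m = ξ t then progress ξ t + 1 else progress ξ t

theorem recv_eq_compress_msg {n d : ℕ} (A : Algorithm.{v} n d) (f : Fin n → E d → ℝ)
    (C : CompressorFamily.{u} n d) (c : A.Coin) (ξ : ℕ → C.Seed) (t : ℕ) (i : Fin n) :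
    A.recv f C c ξ t i = C.compress i (ξ t) (A.msg f C c ξ t i) := by
  rw [Algorithm.recv]
  rfl

section Invariant

variable {n d m : ℕ}

/-- Coordinate `k` is the only one that could be new, and it survives only if its class is drawn. -/
theorem keepClass_mem {s : Fin m} {p k : ℕ} {x : E d} (hx : x ∈ prefixSpace d (reach p k)) :
    keepClass s x ∈ prefixSpace d (if k % m = s then k + 1 else k) := by
  intro j hj
  simp only [keepClass]
  split_ifs at hj with h
  · rw [hx j ((reach_le p k).trans hj), mul_zero, ite_self]
  · rcases hj.eq_or_lt with hjk | hjk
    · rw [if_neg (hjk ▸ h)]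
    · rw [hx j ((reach_le p k).trans hjk), mul_zero, ite_self]

variable [NeZero m] {f : Fin n → E d → ℝ}

/-- A pathwise bound, for every coin and every seed sequence, so adaptivity and randomization do not
help. The three claims are proved together because the spans refer to each other; queries get the
larger prefix since a worker may be one coordinate ahead of the server. -/
theorem progress_invariant
    (hgrad : ∀ (i : Fin n) k x, x ∈ prefixSpace d k →
      gradient (f i) x ∈ prefixSpace d (reach ((i : ℕ) % 2) k))
    {A : Algorithm.{v} n d} (hA : A.LinearSpanning f (classSparsifier n d m))
    (c : A.Coin) (ξ : ℕ → Fin m) (t : ℕ) :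
    (∀ r < t, A.sent f (classSparsifier n d m) c ξ r ∈ prefixSpace d (progress ξ t)) ∧
    (∀ r < t, ∀ i, A.recv f (classSparsifier n d m) c ξ r i ∈ prefixSpace d (progress ξ t)) ∧
    (∀ r < t, ∀ i, ∀ y ∈ A.queries f (classSparsifier n d m) c ξ r i,
      y ∈ prefixSpace d (reach ((i : ℕ) % 2) (progress ξ t))) := by
  induction t with
  | zero => exact ⟨fun _ h => absurd h (by omega), fun _ h => absurd h (by omega),
      fun _ h => absurd h (by omega)⟩
  | succ t ih =>
    obtain ⟨h1, h2, h3⟩ := ih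
    have hsent : A.sent f (classSparsifier n d m) c ξ t ∈ prefixSpace d (progress ξ t) := by
      refine Submodule.span_le.mpr ?_ (hA.sent_mem c ξ t)
      rintro _ (⟨r, hr, rfl⟩ | ⟨r, hr, i, rfl⟩)
      · exact h1 r hr
      · exact h2 r hr i
    have hsent' : ∀ r ≤ t, A.sent f (classSparsifier n d m) c ξ r ∈
        prefixSpace d (progress ξ t) := fun r hr => by
      rcases hr.eq_or_lt with rfl | hr
      · exact hsent
      · exact h1 r hr
    have hstable : ∀ (i : Fin n) x, x ∈ prefixSpace d (reach ((i : ℕ) % 2) (progress ξ t)) →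
        gradient (f i) x ∈ prefixSpace d (reach ((i : ℕ) % 2) (progress ξ t)) := by
      intro i x hx
      have := hgrad i _ x hx
      rwa [reach_reach] at this
    have hle : ∀ i : Fin n, prefixSpace d (progress ξ t) ≤
        prefixSpace d (reach ((i : ℕ) % 2) (progress ξ t)) :=
      fun i => prefixSpace_mono (le_reach _ _)
    have hquery : ∀ r ≤ t, ∀ i, ∀ y ∈ A.queries f (classSparsifier n d m) c ξ r i,
        y ∈ prefixSpace d (reach ((i : ℕ) % 2) (progress ξ t)) := by
      intro r hr i y hy
      rcases hr.eq_or_lt with rfl | hr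
      · refine Submodule.span_le.mpr ?_ (hA.queries_subset c ξ r i hy)
        rintro _ ((⟨r', hr', rfl⟩ | ⟨r', hr', z, hz, rfl⟩) | ⟨r', hr', rfl⟩)
        · exact hle i (hsent' r' hr')
        · exact hstable i z (h3 r' hr' i z hz)
        · exact hle i (h2 r' hr' i)
      · exact h3 r hr i y hy
    have hmsg : ∀ i : Fin n, A.msg f (classSparsifier n d m) c ξ t i ∈
        prefixSpace d (reach ((i : ℕ) % 2) (progress ξ t)) := by
      intro i
      refine Submodule.span_le.mpr ?_ (hA.msg_mem c ξ t i)
      rintro _ ((⟨r', hr', rfl⟩ | ⟨r', hr', z, hz, rfl⟩) | ⟨r', hr', rfl⟩)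
      · exact hle i (hsent' r' hr')
      · exact hstable i z (hquery r' hr' i z hz)
      · exact hle i (h2 r' hr' i)
    have hrecv : ∀ i : Fin n, A.recv f (classSparsifier n d m) c ξ t i ∈
        prefixSpace d (progress ξ (t + 1)) := by
      intro i
      have e : A.recv f (classSparsifier n d m) c ξ t i =
          keepClass (ξ t) (A.msg f (classSparsifier n d m) c ξ t i) :=
        recv_eq_compress_msg A f (classSparsifier n d m) c ξ t i
      rw [e, progress]
      exact keepClass_mem (hmsg i)
    have hprog : progress ξ t ≤ progress ξ (t + 1) := by
      rw [progress]; split_ifs <;> omega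
    have hmono := prefixSpace_mono (d := d) hprog
    refine ⟨fun r hr => hmono (hsent' r (Nat.lt_succ_iff.mp hr)), fun r hr i => ?_,
      fun r hr i y hy => prefixSpace_mono (reach_mono _ hprog)
        (hquery r (Nat.lt_succ_iff.mp hr) i y hy)⟩
    rcases (Nat.lt_succ_iff.mp hr).eq_or_lt with rfl | hr
    · exact hrecv i
    · exact hmono (h2 r hr i)

theorem out_mem_prefixSpace
    (hgrad : ∀ (i : Fin n) k x, x ∈ prefixSpace d k →
      gradient (f i) x ∈ prefixSpace d (reach ((i : ℕ) % 2) k))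
    {A : Algorithm.{v} n d} (hA : A.LinearSpanning f (classSparsifier n d m))
    (c : A.Coin) (ξ : ℕ → Fin m) (t : ℕ) :
    A.out f (classSparsifier n d m) c ξ t ∈ prefixSpace d (progress ξ t) := by
  obtain ⟨h1, h2, -⟩ := progress_invariant hgrad hA c ξ t
  refine Submodule.span_le.mpr ?_ (hA.out_mem c ξ t)
  rintro _ (⟨r, hr, rfl⟩ | ⟨r, hr, i, rfl⟩)
  · exact h1 r hr
  · exact h2 r hr i

end Invariant

/-! ### The law of the progress -/

section Expectation

variable {m : ℕ}

theorem progress_congr {ξ ξ' : ℕ → Fin m} (t : ℕ) (h : ∀ r < t, ξ r = ξ' r) :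
    progress ξ t = progress ξ' t := by
  induction t with
  | zero => rfl
  | succ t ih => rw [progress, progress, ih fun r hr => h r (by omega), h t (by omega)]

variable [NeZero m]

/-- Factoring through the first `t` seeds gives measurability, since the domain is finite, and
independence from the seed of round `t`. The filler `0` for later rounds is never read. -/
theorem exists_progress_eq_restrict (m t : ℕ) [NeZero m] :
    ∃ F : (Finset.range t → Fin m) → ℕ, ∀ ξ : ℕ → Fin m, progress ξ t = F fun i => ξ i := by
  refine ⟨fun v => progress (fun r => if hr : r ∈ Finset.range t then v ⟨r, hr⟩ else 0) t,
    fun ξ => progress_congr t fun r hr => ?_⟩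
  rw [dif_pos (Finset.mem_range.mpr hr)]

theorem measurable_progress (t : ℕ) : Measurable fun ξ : ℕ → Fin m => progress ξ t := by
  obtain ⟨F, hF⟩ := exists_progress_eq_restrict m t
  simp_rw [hF]
  exact (measurable_of_finite F).comp (by fun_prop)

/-- The law of a sequence of independent uniform residue classes. -/
def seedLaw (m : ℕ) [NeZero m] : Measure (ℕ → Fin m) :=
  Measure.infinitePi fun _ : ℕ => (PMF.uniformOfFintype (Fin m)).toMeasure

instance : IsProbabilityMeasure (seedLaw m) := by unfold seedLaw; infer_instance

theorem map_progress_seed (t : ℕ) :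
    (seedLaw m).map (fun ξ => (progress ξ t, ξ t)) =
      ((seedLaw m).map fun ξ => progress ξ t).prod
        (PMF.uniformOfFintype (Fin m)).toMeasure := by
  have hind : ProbabilityTheory.iIndepFun (fun (i : ℕ) (ξ : ℕ → Fin m) => ξ i) (seedLaw m) :=
    ProbabilityTheory.iIndepFun_infinitePi (X := fun _ s => s) fun _ => measurable_id
  have h1 := hind.indepFun_finset (Finset.range t) {t} (by simp) fun i => measurable_pi_apply i
  obtain ⟨F, hF⟩ := exists_progress_eq_restrict m t
  have h2 := h1.comp (measurable_of_finite F)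
    (measurable_pi_apply (⟨t, Finset.mem_singleton_self t⟩ : ({t} : Finset ℕ)))
  have h3 : ProbabilityTheory.IndepFun (fun ξ : ℕ → Fin m => progress ξ t) (fun ξ => ξ t)
      (seedLaw m) := by
    simp_rw [hF]
    exact h2
  rw [h3.map_prod_eq_prod_map_map (measurable_progress t).aemeasurable
    (measurable_pi_apply t).aemeasurable]
  congr 1
  exact Measure.infinitePi_map_eval _ t

theorem integrable_pow_progress {φ : ℝ} (h0 : 0 ≤ φ) (h1 : φ ≤ 1) {α : Type*}
    [MeasurableSpace α] {P : Measure α} [IsFiniteMeasure P] {K : α → ℕ} (hK : Measurable K) :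
    Integrable (fun a => φ ^ K a) P := by
  refine Integrable.of_bound ((measurable_from_nat (f := fun k => φ ^ k)).comp
    hK).aestronglyMeasurable 1 (Filter.Eventually.of_forall fun a => ?_)
  rw [Real.norm_eq_abs, abs_of_nonneg (pow_nonneg h0 _)]
  exact pow_le_one₀ h0 h1

/-- Whatever the current coordinate, its class is drawn with probability `1/m`, so a fresh seed
multiplies the expectation by `(1 - 1/m) + φ/m`. -/
theorem integral_pow_progress {φ : ℝ} (h0 : 0 ≤ φ) (h1 : φ ≤ 1) (t : ℕ) :
    ∫ ξ, φ ^ progress ξ t ∂seedLaw m = (1 - (1 - φ) / m) ^ t := by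
  have hm0 : (m : ℝ) ≠ 0 := by exact_mod_cast NeZero.ne m
  induction t with
  | zero => simp [progress]
  | succ t ih =>
    let g : ℕ × Fin m → ℕ := fun p => if p.1 % m = p.2 then p.1 + 1 else p.1
    have hg : Measurable g := measurable_from_prod_countable_left fun s => measurable_from_nat
    have hpair : Measurable fun ξ : ℕ → Fin m => (progress ξ t, ξ t) :=
      (measurable_progress t).prodMk (measurable_pi_apply t)
    have hmeas : Measurable fun p : ℕ × Fin m => φ ^ g p :=
      (measurable_from_nat (f := fun k => φ ^ k)).comp hg
    have e1 : ∫ ξ, φ ^ progress ξ (t + 1) ∂seedLaw m =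
        ∫ p, φ ^ g p ∂((seedLaw m).map fun ξ => (progress ξ t, ξ t)) := by
      rw [integral_map hpair.aemeasurable hmeas.aestronglyMeasurable]
      rfl
    have hprob : IsProbabilityMeasure ((seedLaw m).map fun ξ => progress ξ t) :=
      Measure.isProbabilityMeasure_map (measurable_progress t).aemeasurable
    rw [e1, map_progress_seed, integral_prod _ (integrable_pow_progress h0 h1 hg)]
    have e2 : ∀ k : ℕ, ∫ s, φ ^ g (k, s) ∂(PMF.uniformOfFintype (Fin m)).toMeasure =
        (1 - (1 - φ) / m) * φ ^ k := by
      intro k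
      rw [integral_uniform]
      have : ∀ s : Fin m, φ ^ g (k, s) = if k % m = s then φ ^ (k + 1) else φ ^ k := by
        intro s
        simp only [g]
        split_ifs <;> rfl
      simp_rw [this]
      rw [sum_ite_residue, nsmul_eq_mul, Nat.cast_sub (Nat.pos_of_neZero m), smul_eq_mul]
      push_cast
      field_simp
      ring
    simp_rw [e2]
    rw [integral_const_mul, integral_map (measurable_progress t).aemeasurable
      (measurable_from_nat (f := fun k => φ ^ k)).aestronglyMeasurable, ih, pow_succ, mul_comm]

end Expectation

/-! ### From decay rates to numbers of rounds -/

section Rounds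

variable {n d m : ℕ} [NeZero m] {f : Fin n → E d → ℝ}

/-- If the suboptimality of the vectors with support in the first `k` coordinates is at least
`M (φ^k - φ^d)`, then the expected suboptimality decays no faster than `(1 - (1 - φ) / m)^t`. -/
theorem decay_le_of_expectedGap_le {M φ ε : ℝ} (hM : 0 ≤ M) (h0 : 0 ≤ φ) (h1 : φ ≤ 1)
    (hε : 0 ≤ ε)
    (hgrad : ∀ (i : Fin n) k x, x ∈ prefixSpace d k →
      gradient (f i) x ∈ prefixSpace d (reach ((i : ℕ) % 2) k))
    (hgap : ∀ k x, x ∈ prefixSpace d k → M * (φ ^ k - φ ^ d) ≤ avg f x - ⨅ y, avg f y)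
    {A : Algorithm.{v} n d} (hA : A.LinearSpanning f (classSparsifier n d m)) {t : ℕ}
    (ht : A.expectedGap f (classSparsifier n d m) t ≤ ENNReal.ofReal ε) :
    M * (1 - (1 - φ) / m) ^ t ≤ ε + M * φ ^ d := by
  have hint : Integrable (fun ξ : ℕ → Fin m => M * φ ^ progress ξ t) (seedLaw m) :=
    (integrable_pow_progress h0 h1 (measurable_progress t)).const_mul M
  have h2 : ENNReal.ofReal (M * (1 - (1 - φ) / m) ^ t) =
      ∫⁻ p : A.Coin × (ℕ → Fin m), ENNReal.ofReal (M * φ ^ progress p.2 t)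
        ∂(A.coinLaw.prod (seedLaw m)) := by
    have hmeas : Measurable fun ξ : ℕ → Fin m => ENNReal.ofReal (M * φ ^ progress ξ t) :=
      (measurable_from_nat (f := fun k => ENNReal.ofReal (M * φ ^ k))).comp (measurable_progress t)
    rw [(measurePreserving_snd (μ := A.coinLaw) (ν := seedLaw m)).lintegral_comp hmeas,
      ← ofReal_integral_eq_lintegral_ofReal hint (Filter.Eventually.of_forall fun ξ =>
        mul_nonneg hM (pow_nonneg h0 _)), integral_const_mul, integral_pow_progress h0 h1]
  have h3 : ∫⁻ p : A.Coin × (ℕ → Fin m), ENNReal.ofReal (M * φ ^ progress p.2 t)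
        ∂(A.coinLaw.prod (seedLaw m)) ≤
      A.expectedGap f (classSparsifier n d m) t + ENNReal.ofReal (M * φ ^ d) := by
    calc _ ≤ ∫⁻ p : A.Coin × (ℕ → Fin m),
          (ENNReal.ofReal (avg f (A.out f (classSparsifier n d m) p.1 p.2 t) - ⨅ y, avg f y) +
            ENNReal.ofReal (M * φ ^ d)) ∂(A.coinLaw.prod (seedLaw m)) := by
          refine lintegral_mono fun p => ?_
          -- The term `M φ^d` is moved to the other side so that the integrand bounded here is
          -- nonnegative, as `ENNReal.ofReal` requires.
          refine le_trans (ENNReal.ofReal_le_ofReal ?_) ENNReal.ofReal_add_le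
          have := hgap _ _ (out_mem_prefixSpace hgrad hA p.1 p.2 t)
          linarith
      _ = _ := by
          rw [lintegral_add_right _ measurable_const, lintegral_const, measure_univ, mul_one]
          rfl
  have hMd : 0 ≤ M * φ ^ d := mul_nonneg hM (pow_nonneg h0 _)
  rw [← h2] at h3
  have h4 := h3.trans (add_le_add_left ht _)
  rw [← ENNReal.ofReal_add hε hMd] at h4
  exact (ENNReal.ofReal_le_ofReal_iff (by positivity)).mp h4

/-- For the ratio `q = e^(-2w)` the equation reads `(2 sinh w)² = θ`, solved by `arsinh`; `w ≤ sinh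
w` then bounds the decay rate. -/
theorem exists_chain_ratio {θ : ℝ} (hθ : 0 < θ) :
    ∃ w : ℝ, 0 < w ∧ w ≤ √θ / 2 ∧ (1 - Real.exp (-2 * w)) ^ 2 = θ * Real.exp (-2 * w) := by
  have hs : 0 < √θ / 2 := by positivity
  refine ⟨Real.arsinh (√θ / 2), Real.arsinh_pos_iff.mpr hs, ?_, ?_⟩
  · have h := Real.self_le_sinh_iff.mpr (Real.arsinh_pos_iff.mpr hs).le
    rwa [Real.sinh_arsinh] at h
  · have h := Real.sinh_arsinh (√θ / 2)
    set w := Real.arsinh (√θ / 2)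
    rw [Real.sinh_eq] at h
    have h2 : Real.exp w - Real.exp (-w) = √θ := by linarith
    have h3 : θ = (Real.exp w - Real.exp (-w)) ^ 2 := by rw [h2, Real.sq_sqrt hθ.le]
    have h4 : Real.exp w * Real.exp (-w) = 1 := by rw [← Real.exp_add]; simp
    have h5 : Real.exp (-2 * w) = Real.exp (-w) ^ 2 := by
      rw [← Real.exp_nat_mul]; congr 1; push_cast; ring
    have h6 : (Real.exp w - Real.exp (-w)) * Real.exp (-w) = 1 - Real.exp (-w) ^ 2 := by
      linear_combination h4
    rw [h3, h5, ← mul_pow, h6]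

theorem rounds_lower_bound_of_decay {δ w ε : ℝ} {m t : ℕ} (hm : 1 ≤ m) (hδ : 0 < δ) (hw : 0 < w)
    (hε : 0 < ε) (hεδ : ε ≤ δ / 16)
    (h : δ / 2 * (1 - (1 - Real.exp (-4 * w)) / m) ^ t ≤ 2 * ε) :
    m * Real.log (δ / ε) / (8 * w) ≤ t := by
  have hm0 : (0 : ℝ) < m := by exact_mod_cast hm
  have hm1 : (1 : ℝ) ≤ m := by exact_mod_cast hm
  have he : 0 < Real.exp (-4 * w) := Real.exp_pos _
  -- Bernoulli's inequality with exponent `1/m ≤ 1`.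
  have hbase : Real.exp (-4 * w / m) ≤ 1 - (1 - Real.exp (-4 * w)) / m := by
    have := rpow_one_add_le_one_add_mul_self (s := Real.exp (-4 * w) - 1) (p := 1 / m)
      (by linarith) (by positivity) (by rw [div_le_one hm0]; exact hm1)
    rw [add_sub_cancel, ← Real.exp_mul] at this
    calc Real.exp (-4 * w / m) = Real.exp (-4 * w * (1 / m)) := by congr 1; ring
      _ ≤ _ := this
      _ = _ := by ring
  have h1 : Real.exp (-4 * w / m) ^ t ≤ 4 * (ε / δ) := by
    have h2 := pow_le_pow_left₀ (Real.exp_pos _).le hbase t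
    have h3 : δ / 2 * Real.exp (-4 * w / m) ^ t ≤ 2 * ε :=
      (mul_le_mul_of_nonneg_left h2 (by positivity)).trans h
    rw [← mul_div_assoc, le_div_iff₀ hδ]
    linarith
  rw [← Real.exp_nat_mul] at h1
  have h4 := Real.log_le_log (Real.exp_pos _) h1
  rw [Real.log_exp, Real.log_mul (by norm_num) (by positivity)] at h4
  have h5 : Real.log (ε / δ) = - Real.log (δ / ε) := by rw [← Real.log_inv, inv_div]
  -- The hypothesis `ε ≤ δ/16` lets half of the logarithm absorb the constant 4.
  have h6 : Real.log 4 ≤ Real.log (δ / ε) / 2 := by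
    have h7 : Real.log 16 ≤ Real.log (δ / ε) := by
      refine Real.log_le_log (by norm_num) ?_
      rw [le_div_iff₀ hε]; linarith
    have h8 : Real.log 16 = 2 * Real.log 4 := by
      rw [show (16 : ℝ) = 4 ^ 2 by norm_num, Real.log_pow]; norm_num
    linarith
  rw [h5] at h4
  rw [div_le_iff₀ (by positivity)]
  have h9 : (t : ℝ) * (-4 * w / m) * m = -(4 * w * t) := by field_simp
  nlinarith [mul_le_mul_of_nonneg_right h4 hm0.le]

end Rounds

/-! ### Assembly of the lower bounds -/

/-- Hard instances for strongly convex functions and `ω`-unbiased compressors. -/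
theorem exists_hard_instance {κ₀ : ℝ} (hκ₀ : 1 < κ₀) {L μ Δ ω ε : ℝ} (hμ : 0 < μ)
    (hL : κ₀ * μ ≤ L) (hΔ : 0 < Δ) (hω : 0 ≤ ω) (hε : 0 < ε) (hεΔ : ε ≤ 1 / 16 * (μ * Δ)) :
    ∃ d₀ : ℕ, ∀ d : ℕ, d₀ ≤ d → ∀ n : ℕ, 2 ≤ n →
      ∃ (f : Fin n → E d → ℝ) (C : CompressorFamily.{0} n d),
        InClass L μ Δ f ∧ C.IsUnbiased ω ∧
        (∀ r : ℕ, 1 ≤ r → (∀ i j, C.bitCost r i = C.bitCost r j) ∧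
          (C.perRoundCost r : ℝ≥0∞) ≤
            ENNReal.ofReal (16 * (d / (1 + ω)) * (r + Real.logb 2 (1 + ω)))) ∧
        ∀ A : Algorithm.{v} n d, A.LinearSpanning f C →
          ENNReal.ofReal (1 / (8 * √(6 * κ₀ / (κ₀ - 1))) *
            ((1 + ω) * √(L / μ) * Real.log (μ * Δ / ε))) ≤ (A.rounds f C ε : ℝ≥0∞) := by
  have hμL : μ < L := by nlinarith
  -- Chosen so that `μ + 3β = L`; `θ` below turns the equation for `q` into the stationarity
  -- condition `hqeq`.
  set β := (L - μ) / 3 with hβ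
  have hβ0 : 0 < β := by rw [hβ]; linarith
  set θ := 2 * μ / β with hθ
  obtain ⟨w, hw0, hwθ, hwq⟩ := exists_chain_ratio (show 0 < θ by positivity)
  set q := Real.exp (-2 * w) with hq
  have hq0 : 0 < q := Real.exp_pos _
  have hq1 : q < 1 := by rw [hq, Real.exp_lt_one_iff]; linarith
  have hqeq : μ * q = β / 2 * (1 - q) ^ 2 := by
    rw [hwq, hθ]; field_simp
  have hφ : q ^ 2 = Real.exp (-4 * w) := by
    rw [hq, ← Real.exp_nat_mul]; congr 1; push_cast; ring
  have hφ1 : q ^ 2 < 1 := by nlinarith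
  set s := √(Δ * (1 - q ^ 2)) with hs
  have hs2 : s ^ 2 = Δ * (1 - q ^ 2) := Real.sq_sqrt (mul_nonneg hΔ.le (by linarith))
  have hsa : s = s / q * q := by field_simp
  have hm1 : 1 ≤ ⌊1 + ω⌋₊ := Nat.le_floor (by push_cast; linarith)
  have hmle : (⌊1 + ω⌋₊ : ℝ) ≤ 1 + ω := Nat.floor_le (by linarith)
  have hmge : 1 + ω ≤ 2 * (⌊1 + ω⌋₊ : ℝ) := by
    have h1 := Nat.lt_floor_add_one (1 + ω)
    have h2 : (1 : ℝ) ≤ (⌊1 + ω⌋₊ : ℝ) := by exact_mod_cast hm1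
    linarith
  generalize ⌊1 + ω⌋₊ = m at hm1 hmle hmge
  have : NeZero m := ⟨by omega⟩
  -- From dimension `N` on, the truncation term `μΔ/2 · φ^d` is at most `ε`.
  obtain ⟨N, hN⟩ := exists_pow_lt_of_lt_one (show 0 < 2 * ε / (μ * Δ) by positivity) hφ1
  refine ⟨max m N, fun d hd n hn => ⟨hardFun n d μ (s / q) β q, classSparsifier n d m,
    hardFun_inClass hn hμ.le hβ0.le (by rw [hβ]; linarith) hq0.le hq1 hsa hqeq hs2,
    classSparsifier_isUnbiased hmle, fun r hr => ⟨bitCost_classSparsifier_eq r,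
      perRoundCost_classSparsifier_le hr hmle hmge (le_of_max_le_left hd)⟩, fun A hA => ?_⟩⟩
  refine ofReal_le_toENNReal_of_forall fun t ht => ?_
  have hdecay := decay_le_of_expectedGap_le (M := μ * Δ / 2) (φ := q ^ 2) (by positivity)
    (by positivity) hφ1.le hε.le (fun i k x hx => gradient_hardFun_mem i hx)
    (fun k x hx => hardFun_gap hn hμ.le hβ0.le hq0.le hq1 hΔ.le hsa hqeq hs2 hx) hA ht
  have htail : μ * Δ / 2 * (q ^ 2) ^ d ≤ ε := by
    have h1 : (q ^ 2) ^ d ≤ 2 * ε / (μ * Δ) :=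
      (pow_le_pow_of_le_one (by positivity) hφ1.le (le_of_max_le_right hd)).trans hN.le
    calc μ * Δ / 2 * (q ^ 2) ^ d ≤ μ * Δ / 2 * (2 * ε / (μ * Δ)) := by gcongr
      _ = ε := by field_simp
  rw [hφ] at hdecay htail
  have hrounds := rounds_lower_bound_of_decay hm1 (by positivity : 0 < μ * Δ) hw0 hε
    (by linarith) (hdecay.trans (by linarith))
  refine le_trans ?_ hrounds
  have hlog : 0 ≤ Real.log (μ * Δ / ε) := by
    refine Real.log_nonneg ?_
    rw [le_div_iff₀ hε]; nlinarith [mul_pos hμ hΔ]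
  set Γ := √(6 * κ₀ / (κ₀ - 1)) with hΓ
  have hκ₀' : 0 < κ₀ - 1 := by linarith
  have hΓ0 : 0 < Γ := by rw [hΓ]; positivity
  have hL0 : 0 < L := hμ.trans hμL
  -- The only use of `κ₀`: `L/(L - μ) ≤ κ₀/(κ₀ - 1)` keeps `w √κ` bounded.
  have hwΓ : w * √(L / μ) ≤ Γ / 2 := by
    have h1 : √θ * √(L / μ) ≤ Γ := by
      rw [← Real.sqrt_mul (by positivity), hΓ]
      refine Real.sqrt_le_sqrt ?_
      rw [hθ, hβ]
      have e : 2 * μ / ((L - μ) / 3) * (L / μ) = 6 * L / (L - μ) := by field_simp; ring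
      rw [e, div_le_div_iff₀ (by linarith) hκ₀']
      nlinarith
    have h2 := mul_le_mul_of_nonneg_right hwθ (Real.sqrt_nonneg (L / μ))
    linarith
  rw [div_mul_eq_mul_div, one_mul, div_le_div_iff₀ (by positivity) (by positivity)]
  calc (1 + ω) * √(L / μ) * Real.log (μ * Δ / ε) * (8 * w)
      = 8 * ((1 + ω) * Real.log (μ * Δ / ε)) * (w * √(L / μ)) := by ring
    _ ≤ 8 * (2 * m * Real.log (μ * Δ / ε)) * (Γ / 2) := by
        have : 0 ≤ 1 + ω := by linarith
        gcongr
    _ = _ := by ring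

/-- A lower bound on the number of rounds gives one on the total communication cost. -/
theorem tcc_lower_bound {n d r : ℕ} {ω ε B : ℝ} (hn : 1 ≤ n) (hr : 1 ≤ r) (hω : 0 ≤ ω)
    {f : Fin n → E d → ℝ} {C : CompressorFamily.{u} n d} (hC : C.IsUnbiased ω)
    {A : Algorithm.{v} n d}
    (h : ENNReal.ofReal ((1 + ω) * B) ≤ (A.rounds f C ε : ℝ≥0∞)) :
    ENNReal.ofReal (3 / 64 * (d * B)) ≤ A.tcc f C r ε := by
  have h1 : ENNReal.ofReal (3 / 64 * (d / (1 + ω))) ≤ (C.perRoundCost r : ℝ≥0∞) := by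
    refine (bitCost_lower_bound hr hω hC ⟨0, hn⟩).trans ?_
    exact ENat.toENNReal_le.mpr (le_iSup (fun i => C.bitCost r i) ⟨0, hn⟩)
  refine le_trans (le_of_eq ?_) (mul_le_mul' h1 h)
  rw [← ENNReal.ofReal_mul (by positivity)]
  congr 1
  have : 1 + ω ≠ 0 := by positivity
  field_simp

theorem InClass.mono_convexity {n d : ℕ} {L μ Δ : ℝ} (hμ : 0 ≤ μ) {f : Fin n → E d → ℝ}
    (h : InClass L μ Δ f) : InClass L 0 Δ f where
  differentiable := h.differentiable
  strong_convex := fun i x y => by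
    refine le_trans ?_ (h.strong_convex i x y)
    gcongr
  smooth := h.smooth
  minimizer := h.minimizer

/-- A smaller constant turns a lower bound on the rounds into bounds on rounds and total cost. -/
theorem rounds_and_tcc_lower_bound {n d : ℕ} {ω ε c B : ℝ} (hn : 1 ≤ n) (hω : 0 ≤ ω)
    (hc : 0 ≤ c) (hB : 0 ≤ B) {f : Fin n → E d → ℝ} {C : CompressorFamily.{u} n d}
    (hC : C.IsUnbiased ω) {A : Algorithm.{v} n d}
    (h : ENNReal.ofReal (c * ((1 + ω) * B)) ≤ (A.rounds f C ε : ℝ≥0∞)) :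
    ENNReal.ofReal (3 / 64 * c * ((1 + ω) * B)) ≤ (A.rounds f C ε : ℝ≥0∞) ∧
      ∀ r : ℕ, 1 ≤ r → ENNReal.ofReal (3 / 64 * c * (d * B)) ≤ A.tcc f C r ε := by
  refine ⟨le_trans (ENNReal.ofReal_le_ofReal ?_) h, fun r hr => ?_⟩
  · have : 0 ≤ c * ((1 + ω) * B) := by positivity
    linarith
  · have h' : ENNReal.ofReal ((1 + ω) * (c * B)) ≤ (A.rounds f C ε : ℝ≥0∞) := by
      rwa [mul_left_comm]
    refine le_trans (le_of_eq ?_) (tcc_lower_bound hn hr hω hC h')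
    congr 1
    ring

theorem strongly_convex_lower_bound {κ₀ : ℝ} (hκ₀ : 1 < κ₀) :
    ∃ c c₀ K : ℝ, 0 < c ∧ 0 < c₀ ∧ 0 < K ∧
      ∀ L μ Δ ω ε : ℝ, 0 < μ → κ₀ * μ ≤ L → 0 < Δ → 0 ≤ ω → 0 < ε → ε ≤ c₀ * (μ * Δ) →
      ∃ d₀ : ℕ, ∀ d : ℕ, d₀ ≤ d → ∀ n : ℕ, 2 ≤ n →
      ∃ (f : Fin n → E d → ℝ) (C : CompressorFamily.{0} n d),
        InClass L μ Δ f ∧ C.IsUnbiased ω ∧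
        (∀ r : ℕ, 1 ≤ r → (∀ i j, C.bitCost r i = C.bitCost r j) ∧
          (C.perRoundCost r : ℝ≥0∞) ≤
            ENNReal.ofReal (K * (d / (1 + ω)) * (r + Real.logb 2 (1 + ω)))) ∧
        ∀ A : Algorithm.{v} n d, A.LinearSpanning f C →
          ENNReal.ofReal (c * ((1 + ω) * √(L / μ) * Real.log (μ * Δ / ε))) ≤
            (A.rounds f C ε : ℝ≥0∞) ∧
          ∀ r : ℕ, 1 ≤ r →
            ENNReal.ofReal (c * (d * (√(L / μ) * Real.log (μ * Δ / ε)))) ≤ A.tcc f C r ε := by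
  have hκ₀' : 0 < κ₀ - 1 := by linarith
  refine ⟨3 / 64 * (1 / (8 * √(6 * κ₀ / (κ₀ - 1)))), 1 / 16, 16, by positivity, by norm_num,
    by norm_num, fun L μ Δ ω ε hμ hL hΔ hω hε hεΔ => ?_⟩
  obtain ⟨d₀, h⟩ := exists_hard_instance.{v} hκ₀ hμ hL hΔ hω hε hεΔ
  refine ⟨d₀, fun d hd n hn => ?_⟩
  obtain ⟨f, C, hf, hC, hcost, hA⟩ := h d hd n hn
  refine ⟨f, C, hf, hC, hcost, fun A hlin => ?_⟩
  have hlog : 0 ≤ Real.log (μ * Δ / ε) := by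
    refine Real.log_nonneg ?_
    rw [le_div_iff₀ hε]
    nlinarith [mul_pos hμ hΔ]
  rw [mul_assoc (1 + ω)]
  refine rounds_and_tcc_lower_bound (by omega) hω (by positivity) (by positivity) hC ?_
  rw [← mul_assoc (1 + ω)]
  exact hA A hlin

/-- The convex case follows from the strongly convex one with parameter `16 ε / Δ`. -/
theorem convex_lower_bound :
    ∃ c c₀ K : ℝ, 0 < c ∧ 0 < c₀ ∧ 0 < K ∧
      ∀ L Δ ω ε : ℝ, 0 < L → 0 < Δ → 0 ≤ ω → 0 < ε → ε ≤ c₀ * (L * Δ) →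
      ∃ d₀ : ℕ, ∀ d : ℕ, d₀ ≤ d → ∀ n : ℕ, 2 ≤ n →
      ∃ (f : Fin n → E d → ℝ) (C : CompressorFamily.{0} n d),
        InClass L 0 Δ f ∧ C.IsUnbiased ω ∧
        (∀ r : ℕ, 1 ≤ r → (∀ i j, C.bitCost r i = C.bitCost r j) ∧
          (C.perRoundCost r : ℝ≥0∞) ≤
            ENNReal.ofReal (K * (d / (1 + ω)) * (r + Real.logb 2 (1 + ω)))) ∧
        ∀ A : Algorithm.{v} n d, A.LinearSpanning f C →
          ENNReal.ofReal (c * ((1 + ω) * √(L * Δ / ε))) ≤ (A.rounds f C ε : ℝ≥0∞) ∧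
          ∀ r : ℕ, 1 ≤ r →
            ENNReal.ofReal (c * (d * √(L * Δ / ε))) ≤ A.tcc f C r ε := by
  have hlog16 : 0 < Real.log 16 := Real.log_pos (by norm_num)
  refine ⟨3 / 64 * (1 / (8 * √(6 * 2 / (2 - 1))) * (Real.log 16 / 4)), 1 / 32, 16, ?_,
    by norm_num, by norm_num, fun L Δ ω ε hL hΔ hω hε hεΔ => ?_⟩
  · have : (0 : ℝ) < √(6 * 2 / (2 - 1)) := Real.sqrt_pos.mpr (by norm_num)
    positivity
  -- With this `μ`, `ε = μΔ/16` sits at the threshold of the strongly convex bound, the logarithm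
  -- becomes `log 16`, and `√(L/μ) = √(LΔ/ε)/4`. The constant `1/32` is what `κ₀ = 2` requires.
  have hμ : 0 < 16 * ε / Δ := by positivity
  have hμΔ : 16 * ε / Δ * Δ = 16 * ε := div_mul_cancel₀ _ hΔ.ne'
  obtain ⟨d₀, h⟩ := exists_hard_instance.{v} one_lt_two hμ
    (L := L) (by rw [← mul_div_assoc, div_le_iff₀ hΔ]; linarith) hΔ hω hε
    (by rw [hμΔ]; linarith)
  refine ⟨d₀, fun d hd n hn => ?_⟩
  obtain ⟨f, C, hf, hC, hcost, hA⟩ := h d hd n hn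
  refine ⟨f, C, hf.mono_convexity hμ.le, hC, hcost, fun A hlin => ?_⟩
  refine rounds_and_tcc_lower_bound (by omega) hω (by positivity) (by positivity) hC ?_
  have hA' := hA A hlin
  have e1 : √(L / (16 * ε / Δ)) = √(L * Δ / ε) / 4 := by
    have e : L / (16 * ε / Δ) = L * Δ / ε / 4 ^ 2 := by field_simp; norm_num
    rw [e, Real.sqrt_div (by positivity), Real.sqrt_sq (by norm_num)]
  rw [e1, hμΔ, mul_div_cancel_right₀ _ hε.ne'] at hA'
  refine le_trans (le_of_eq ?_) hA'
  congr 1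
  ring

end DistOpt

end

theorem theorem1 :
    -- every `ω`-unbiased compressor costs `Ω(d/(1+ω))` bits per round
    (∃ c : ℝ, 0 < c ∧
      ∀ (n d r : ℕ) (ω : ℝ), 1 ≤ r → 0 ≤ ω →
      ∀ C : DistOpt.CompressorFamily.{u} n d, C.IsUnbiased ω →
      ∀ i, ENNReal.ofReal (c * (d / (1 + ω))) ≤ (C.bitCost r i : ℝ≥0∞)) ∧
    -- strongly convex case: lower bound for all algorithms with `ω`-unbiased compression
    (∀ κ₀ : ℝ, 1 < κ₀ → ∃ c c₀ K : ℝ, 0 < c ∧ 0 < c₀ ∧ 0 < K ∧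
      ∀ L μ Δ ω ε : ℝ, 0 < μ → κ₀ * μ ≤ L → 0 < Δ → 0 ≤ ω → 0 < ε → ε ≤ c₀ * (μ * Δ) →
      ∃ d₀ : ℕ, ∀ d : ℕ, d₀ ≤ d → ∀ n : ℕ, 2 ≤ n →
      ∃ (f : Fin n → DistOpt.E d → ℝ) (C : DistOpt.CompressorFamily.{0} n d),
        DistOpt.InClass L μ Δ f ∧ C.IsUnbiased ω ∧
        (∀ r : ℕ, 1 ≤ r → (∀ i j, C.bitCost r i = C.bitCost r j) ∧
          (C.perRoundCost r : ℝ≥0∞) ≤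
            ENNReal.ofReal (K * (d / (1 + ω)) * (r + Real.logb 2 (1 + ω)))) ∧
        ∀ A : DistOpt.Algorithm.{v} n d, A.LinearSpanning f C →
          ENNReal.ofReal (c * ((1 + ω) * √(L / μ) * Real.log (μ * Δ / ε))) ≤
            (A.rounds f C ε : ℝ≥0∞) ∧
          ∀ r : ℕ, 1 ≤ r →
            ENNReal.ofReal (c * (d * (√(L / μ) * Real.log (μ * Δ / ε)))) ≤ A.tcc f C r ε) ∧
    -- generally convex case: lower bound for all algorithms with `ω`-unbiased compression
    (∃ c c₀ K : ℝ, 0 < c ∧ 0 < c₀ ∧ 0 < K ∧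
      ∀ L Δ ω ε : ℝ, 0 < L → 0 < Δ → 0 ≤ ω → 0 < ε → ε ≤ c₀ * (L * Δ) →
      ∃ d₀ : ℕ, ∀ d : ℕ, d₀ ≤ d → ∀ n : ℕ, 2 ≤ n →
      ∃ (f : Fin n → DistOpt.E d → ℝ) (C : DistOpt.CompressorFamily.{0} n d),
        DistOpt.InClass L 0 Δ f ∧ C.IsUnbiased ω ∧
        (∀ r : ℕ, 1 ≤ r → (∀ i j, C.bitCost r i = C.bitCost r j) ∧
          (C.perRoundCost r : ℝ≥0∞) ≤
            ENNReal.ofReal (K * (d / (1 + ω)) * (r + Real.logb 2 (1 + ω)))) ∧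
        ∀ A : DistOpt.Algorithm.{v} n d, A.LinearSpanning f C →
          ENNReal.ofReal (c * ((1 + ω) * √(L * Δ / ε))) ≤ (A.rounds f C ε : ℝ≥0∞) ∧
          ∀ r : ℕ, 1 ≤ r →
            ENNReal.ofReal (c * (d * √(L * Δ / ε))) ≤ A.tcc f C r ε) ∧
    -- the same orders are attained without compression, which is `ω`-unbiased for all `ω ≥ 0`
    (∀ (n d : ℕ) (ω : ℝ), 0 ≤ ω → (DistOpt.noCompression n d).IsUnbiased ω) ∧
    (∃ c₀ K : ℝ, 0 < c₀ ∧ 0 < K ∧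
      (∀ (n d : ℕ) (L μ : ℝ), 1 ≤ n → 0 < μ → μ ≤ L →
        ∃ A : DistOpt.Algorithm.{0} n d, ∀ (Δ : ℝ) (f : Fin n → DistOpt.E d → ℝ),
          DistOpt.InClass L μ Δ f →
          A.LinearSpanning f (DistOpt.noCompression n d) ∧
          ∀ (ε : ℝ) (r : ℕ), 0 < ε → ε ≤ c₀ * (μ * Δ) → 1 ≤ r →
            A.tcc f (DistOpt.noCompression n d) r ε ≤
              ENNReal.ofReal (K * (r * d * (√(L / μ) * Real.log (μ * Δ / ε))))) ∧
      (∀ (n d : ℕ) (L : ℝ), 1 ≤ n → 0 < L →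
        ∃ A : DistOpt.Algorithm.{0} n d, ∀ (Δ : ℝ) (f : Fin n → DistOpt.E d → ℝ),
          DistOpt.InClass L 0 Δ f →
          A.LinearSpanning f (DistOpt.noCompression n d) ∧
          ∀ (ε : ℝ) (r : ℕ), 0 < ε → ε ≤ c₀ * (L * Δ) → 1 ≤ r →
            A.tcc f (DistOpt.noCompression n d) r ε ≤
              ENNReal.ofReal (K * (r * d * √(L * Δ / ε))))) := by
  refine ⟨⟨3 / 64, by norm_num, fun n d r ω hr hω C hC i =>
      DistOpt.bitCost_lower_bound hr hω hC i⟩,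
    fun κ₀ hκ₀ => DistOpt.strongly_convex_lower_bound hκ₀,
    DistOpt.convex_lower_bound,
    fun n d ω hω => DistOpt.noCompression_isUnbiased n d hω,
    -- The threshold `e⁻¹` makes `log(μΔ/ε) ≥ 1`, so that additive constants can be absorbed.
    Real.exp (-1), 8, Real.exp_pos _, by norm_num,
    fun n d L μ hn hμ hL => ⟨DistOpt.acceleratedGradient n d L μ, fun Δ f hf =>
      ⟨DistOpt.acceleratedGradient_linearSpanning f, fun ε r hε hεΔ _ =>
        DistOpt.acc_tcc_strongly_convex hn hμ hL hf r hε hεΔ⟩⟩,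
    fun n d L hn hL => ⟨DistOpt.acceleratedGradient n d L 0, fun Δ f hf =>
      ⟨DistOpt.acceleratedGradient_linearSpanning f, fun ε r hε hεΔ _ =>
        DistOpt.acc_tcc_convex hn hL hf r hε hεΔ⟩⟩⟩
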